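/- Let $d\ge 1$, let $\Omega\subset\mathbb R^d$ be open and bounded, and let $\theta$ range over the unit sphere $\mathbb S^{d-1}$. *Notation.* $W_\theta(\Omega)$ is the set of $u\in L^2(\Omega)$ that have a weak derivative $\partial_\theta u\in L^2(\Omega)$ along $\theta$, i.e. $\int_\Omega u\,\theta\cdot\nabla\varphi=-\int_\Omega \partial_\theta u\,\varphi$ for all $\varphi\in C_c^\infty(\Omega)$. For $x\in\Omega$ let $\delta_\theta(x)=\sup\{s\ge0:\ x+t\theta\in\Omega\ \forall t\in[0,s)\}$ and $\Phi_\theta(x)=x+\delta_\theta(x)\theta$; let $\partial_\theta\Omega=\Phi_\theta(\Omega)\subset\partial\Omega$, and let $\mu_\theta$ be the image under $\Phi_\theta$ of Lebesgue measure on $\Omega$. For $z=\Phi_\theta(x)\in\partial_\theta\Omega$ let $\ell_{-\theta}(z)=\delta_\theta(x)+\delta_{-\theta}(x)$ (the length of the chord of $\Omega$ parallel to $\theta$ that ends at $z$). For $y\in\theta^\perp$ let $\omega_\theta(y)=\{s\in\mathbb R: s\theta+y\in\Omega\}$, and let $P_\theta$ be the orthogonal projection onto $\theta^\perp$. A function $g:\partial\Omega\to\mathbb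 R$ is a *directional trace* of $u\in W_\theta(\Omega)$ in the direction $\theta$, written $g=\gamma_\theta u$, if for some representative of $u$ and for $\lambda^{d-1}$-a.e. $y\in P_\theta(\Omega)$ the function $s\mapsto u(s\theta+y)$ belongs to $H^1(\omega_\theta(y))$ and, for each component $(\alpha,\beta)$ of $\omega_\theta(y)$, its representative on $(\alpha,\beta)$ that is continuous on $(\alpha,\beta]$ takes the value $g(\beta\theta+y)$ at $\beta$. $L^2(\partial\Omega,(\mu_\theta)_\theta)$ is the set of $g:\partial\Omega\to\mathbb R$ that are in $L^2(\mu_\theta)$ for every $\theta$ with norms bounded independently of $\theta$. $H^1_{\rm tr}(\Omega)$ is the set of $u\in H^1(\Omega)$ for which there is $g=:{\rm tr}(u)$ in this space with $\gamma_\theta u=g$ $\mu_\theta$-a.e. for every $\theta\in\mathbb S^{d-1}$. For $\varepsilon>0$ put $$u_{\theta,\varepsilon}(z)=\frac1{\min(\varepsilon,\ell_{-\theta}(z))}\int_0^{\min(\varepsilon,\ell_{-\theta}(z))}u(z-s\theta)\,ds .$$ **Theorem.** 1. Let $\theta\in\mathbb S^{d-1}$ and $u\in W_\theta(\Omega)$.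 Then $u$ has a directional trace in the direction $\theta$. For $\mu_\theta$-a.e. $z\in\partial_\theta\Omega$ we have $\ell_{-\theta}(z)>0$ and $s\mapsto u(z-s\theta)$ is integrable on $(0,\ell_{-\theta}(z))$, so that $u_{\theta,\varepsilon}(z)$ is well defined for all $\varepsilon>0$. For every directional trace $\gamma_\theta u$ of $u$, $$\lim_{\varepsilon\to0^+}u_{\theta,\varepsilon}(z)=\gamma_\theta u(z)\quad\text{for }\mu_\theta\text{-a.e. }z\in\partial_\theta\Omega,$$ and, for every $\varepsilon>0$, $\gamma_\theta u-u_{\theta,\varepsilon}\in L^2(\partial_\theta\Omega,\mu_\theta)$ and $$\int_{\partial_\theta\Omega}\big(\gamma_\theta u(z)-u_{\theta,\varepsilon}(z)\big)^2\,d\mu_\theta(z)\le\varepsilon\,{\rm diam}(\Omega)\,\|\partial_\theta u\|_{L^2(\Omega)}^2 .$$ 2. Let $u\in H^1_{\rm tr}(\Omega)$. Then for every $\theta\in\mathbb S^{d-1}$ and $\mu_\theta$-a.e. $z\in\partial_\theta\Omega$ the averages $u_{\theta,\varepsilon}(z)$ are well defined in the above sense and $\lim_{\varepsilon\to0^+}u_{\theta,\varepsilon}(z)={\rm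 tr}(u)(z)$. Moreover, for every $\varepsilon>0$, the functions ${\rm tr}(u)-u_{\theta,\varepsilon}$ belong to $L^2(\partial_\theta\Omega,\mu_\theta)$ for every $\theta\in\mathbb S^{d-1}$, and $$\sup_{\theta\in\mathbb S^{d-1}}\int_{\partial_\theta\Omega}\big({\rm tr}(u)(z)-u_{\theta,\varepsilon}(z)\big)^2\,d\mu_\theta(z)\le\varepsilon\,{\rm diam}(\Omega)\,\|\nabla u\|_{L^2(\Omega)}^2 .$$ -/

import Mathlib

open MeasureTheory Set Filter Topology
open scoped ContDiff RealInnerProductSpace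

namespace DirTrace

noncomputable section

/-! ### Weak directional derivatives, `W_θ(Ω)` and `H¹(Ω)` -/

section Weak

variable {E : Type*} [NormedAddCommGroup E] [NormedSpace ℝ E] [MeasureSpace E]

/-- `v ∈ L²(Ω)` is the weak derivative of `u` along `θ` in the open set `Ω`:
`∫_Ω u ∂_θ φ = - ∫_Ω v φ` for all `φ ∈ C^∞_c(Ω)`. -/
def IsWeakDirDeriv (Ω : Set E) (θ : E) (u v : E → ℝ) : Prop :=
  MemLp v 2 (volume.restrict Ω) ∧
    ∀ φ : E → ℝ, ContDiff ℝ ∞ φ → HasCompactSupport φ → tsupport φ ⊆ Ω →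
      ∫ x in Ω, u x * fderiv ℝ φ x θ = - ∫ x in Ω, v x * φ x

/-- `u ∈ W_θ(Ω)`: both `u` and its weak derivative along `θ` belong to `L²(Ω)`. -/
def MemW (Ω : Set E) (θ : E) (u : E → ℝ) : Prop :=
  MemLp u 2 (volume.restrict Ω) ∧ ∃ v : E → ℝ, IsWeakDirDeriv Ω θ u v

end Weak

/-- `f ∈ H¹(S)` for an open set `S ⊆ ℝ`. -/
def MemH1Line (S : Set ℝ) (f : ℝ → ℝ) : Prop := MemW S (1 : ℝ) f

variable {d : ℕ}

/-- `G = ∇u ∈ L²(Ω)^d` in the weak sense: the `i`-th component of `G` is the weak `i`-th partial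
derivative of `u`. -/
def IsWeakGrad (Ω : Set (EuclideanSpace ℝ (Fin d))) (u : EuclideanSpace ℝ (Fin d) → ℝ)
    (G : EuclideanSpace ℝ (Fin d) → EuclideanSpace ℝ (Fin d)) : Prop :=
  ∀ i : Fin d, IsWeakDirDeriv Ω (EuclideanSpace.single i (1 : ℝ)) u (fun x => G x i)

/-- `u ∈ H¹(Ω)`. -/
def MemH1 (Ω : Set (EuclideanSpace ℝ (Fin d))) (u : EuclideanSpace ℝ (Fin d) → ℝ) : Prop :=
  MemLp u 2 (volume.restrict Ω) ∧ ∃ G, IsWeakGrad Ω u G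

/-! ### Geometry of `Ω` in the direction `θ` -/

/-- `δ_θ(x) = sup {s ≥ 0 : ∀ t ∈ [0, s[, x + t θ ∈ Ω}`. -/
def delta (Ω : Set (EuclideanSpace ℝ (Fin d))) (θ x : EuclideanSpace ℝ (Fin d)) : ℝ :=
  sSup {s : ℝ | 0 ≤ s ∧ ∀ t ∈ Ico 0 s, x + t • θ ∈ Ω}

/-- `Φ_θ(x) = x + δ_θ(x) θ`. -/
def Phi (Ω : Set (EuclideanSpace ℝ (Fin d))) (θ x : EuclideanSpace ℝ (Fin d)) :
    EuclideanSpace ℝ (Fin d) :=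
  x + delta Ω θ x • θ

/-- `∂_θ Ω = Φ_θ(Ω)`, the part of the boundary seen from `Ω` in the direction `θ`. -/
def dirBoundary (Ω : Set (EuclideanSpace ℝ (Fin d))) (θ : EuclideanSpace ℝ (Fin d)) :
    Set (EuclideanSpace ℝ (Fin d)) :=
  Phi Ω θ '' Ω

/-- For `z ∈ ∂_θ Ω`, this is `ℓ_{-θ}(z)`, the length of the chord of `Ω` parallel to `θ` that ends
at `z`; see `chordLength_Phi`. -/
def chordLength (Ω : Set (EuclideanSpace ℝ (Fin d))) (θ z : EuclideanSpace ℝ (Fin d)) : ℝ :=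
  sSup {s : ℝ | 0 ≤ s ∧ ∀ t ∈ Ioo 0 s, z - t • θ ∈ Ω}

/-- The directional measure `μ_θ(A) = ∫_Ω χ_A(Φ_θ(x)) dx`, regarded as a measure on the whole
space (it is carried by `∂_θ Ω ⊆ ∂Ω`); see `dirMeasure_apply`. -/
def dirMeasure (Ω : Set (EuclideanSpace ℝ (Fin d))) (θ : EuclideanSpace ℝ (Fin d)) :
    Measure (EuclideanSpace ℝ (Fin d)) :=
  Measure.map (Phi Ω θ) (volume.restrict Ω)

/-- The hyperplane `H_θ` orthogonal to `θ`. -/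
abbrev hyp (θ : EuclideanSpace ℝ (Fin d)) : Submodule ℝ (EuclideanSpace ℝ (Fin d)) :=
  (Submodule.span ℝ {θ})ᗮ

/-- The Lebesgue measure `λ^{d-1}` on the hyperplane `H_θ`. -/
def hypMeasure (θ : EuclideanSpace ℝ (Fin d)) : Measure (hyp θ) :=
  (stdOrthonormalBasis ℝ (hyp θ)).toBasis.addHaar

/-- `P_θ(Ω)`, the image of `Ω` by the orthogonal projection `x ↦ x - (x · θ) θ` onto `H_θ`. -/
def projSet (Ω : Set (EuclideanSpace ℝ (Fin d))) (θ : EuclideanSpace ℝ (Fin d)) : Set (hyp θ) :=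
  {y | ∃ x ∈ Ω, (y : EuclideanSpace ℝ (Fin d)) = x - ⟪x, θ⟫ • θ}

/-- `ω_θ(y) = {s ∈ ℝ : s θ + y ∈ Ω}`. -/
def slice (Ω : Set (EuclideanSpace ℝ (Fin d))) (θ y : EuclideanSpace ℝ (Fin d)) : Set ℝ :=
  {s | s • θ + y ∈ Ω}

/-- `]α, β[` is one of the disjoint bounded open intervals that make up the bounded open
set `S ⊆ ℝ`. -/
def IsComponentInterval (S : Set ℝ) (α β : ℝ) : Prop :=
  α < β ∧ Ioo α β ⊆ S ∧ α ∉ S ∧ β ∉ S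

/-! ### Directional and omnidirectional traces

Functions on `∂Ω` are represented by functions on the whole space, of which only the values on
`∂Ω` matter. -/

/-- `g` is a directional trace of `u` in the direction `θ`: for some representative `w` of `u` and
`λ^{d-1}`-a.e. `y ∈ P_θ(Ω)`, the restriction of `w` to the line through `y` is in `H¹(ω_θ(y))`,
and on each interval `]α, β[` of `ω_θ(y)` its representative that is continuous on `]α, β]` takes
the value `g(β θ + y)` at `β`. -/
def IsDirTrace (Ω : Set (EuclideanSpace ℝ (Fin d))) (θ : EuclideanSpace ℝ (Fin d))
    (u g : EuclideanSpace ℝ (Fin d) → ℝ) : Prop :=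
  ∃ w : EuclideanSpace ℝ (Fin d) → ℝ, w =ᵐ[volume.restrict Ω] u ∧
    ∃ A : Set (hyp θ), A ⊆ projSet Ω θ ∧ hypMeasure θ (projSet Ω θ \ A) = 0 ∧
      ∀ y ∈ A,
        MemH1Line (slice Ω θ y) (fun s => w (s • θ + y)) ∧
        ∀ α β : ℝ, IsComponentInterval (slice Ω θ y) α β →
          ∃ f : ℝ → ℝ, f =ᵐ[volume.restrict (Ioo α β)] (fun s => w (s • θ + y)) ∧
            ContinuousOn f (Ioc α β) ∧ g (β • θ + y) = f β

/-- `g` belongs to `L²(∂Ω, (μ_θ)_θ)`: it is in `L²(μ_θ)` for every unit vector `θ`, with a norm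
bounded independently of `θ`. -/
def MemL2Family (Ω : Set (EuclideanSpace ℝ (Fin d))) (g : EuclideanSpace ℝ (Fin d) → ℝ) : Prop :=
  ∃ M : ℝ, 0 ≤ M ∧ ∀ θ ∈ Metric.sphere (0 : EuclideanSpace ℝ (Fin d)) 1,
    MemLp g 2 (dirMeasure Ω θ) ∧ ∫ z, g z ^ 2 ∂(dirMeasure Ω θ) ≤ M

/-- `g = tr(u)` is the omnidirectional trace of `u`: it belongs to `L²(∂Ω, (μ_θ)_θ)` and
`γ_θ u = g` `μ_θ`-a.e. for every unit vector `θ`. -/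
def IsOmniTrace (Ω : Set (EuclideanSpace ℝ (Fin d))) (u g : EuclideanSpace ℝ (Fin d) → ℝ) : Prop :=
  MemL2Family Ω g ∧ ∀ θ ∈ Metric.sphere (0 : EuclideanSpace ℝ (Fin d)) 1,
    ∃ γ : EuclideanSpace ℝ (Fin d) → ℝ, IsDirTrace Ω θ u γ ∧ γ =ᵐ[dirMeasure Ω θ] g

/-- `u ∈ H¹_tr(Ω)`: `u ∈ H¹(Ω)` has an omnidirectional trace. -/
def MemH1tr (Ω : Set (EuclideanSpace ℝ (Fin d))) (u : EuclideanSpace ℝ (Fin d) → ℝ) : Prop :=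
  MemH1 Ω u ∧ ∃ g, IsOmniTrace Ω u g

/-- The one-sided average
`u_{θ,ε}(z) = (1 / min(ε, ℓ_{-θ}(z))) ∫_0^{min(ε, ℓ_{-θ}(z))} u(z - s θ) ds`. -/
def dirAverage (Ω : Set (EuclideanSpace ℝ (Fin d))) (θ : EuclideanSpace ℝ (Fin d))
    (u : EuclideanSpace ℝ (Fin d) → ℝ) (ε : ℝ) (z : EuclideanSpace ℝ (Fin d)) : ℝ :=
  1 / min ε (chordLength Ω θ z) * ∫ s in (0 : ℝ)..min ε (chordLength Ω θ z), u (z - s • θ)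

/-! ### The definitions of `μ_θ` and of the chord length are meaningful -/

variable {Ω : Set (EuclideanSpace ℝ (Fin d))} {θ : EuclideanSpace ℝ (Fin d)}

theorem le_diam_of_mem (hb : Bornology.IsBounded Ω) (hθ : ‖θ‖ = 1)
    {x : EuclideanSpace ℝ (Fin d)} {s : ℝ} (hs : ∀ t ∈ Ioo 0 s, x + t • θ ∈ Ω) :
    s ≤ Metric.diam Ω := by
  by_contra! h
  have h0 : 0 ≤ Metric.diam Ω := Metric.diam_nonneg
  set D := Metric.diam Ω
  have h1 := hs ((s - D) / 3) ⟨by linarith, by linarith⟩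
  have h2 := hs ((s - D) / 2 + D) ⟨by linarith, by linarith⟩
  have h3 := Metric.dist_le_diam_of_mem hb h2 h1
  rw [dist_add_left, dist_eq_norm, ← sub_smul, norm_smul, hθ, mul_one, Real.norm_eq_abs] at h3
  have h4 := (le_abs_self _).trans h3
  change _ ≤ D at h4
  linarith

theorem bddAbove_delta (hb : Bornology.IsBounded Ω) (hθ : ‖θ‖ = 1)
    (x : EuclideanSpace ℝ (Fin d)) :
    BddAbove {s : ℝ | 0 ≤ s ∧ ∀ t ∈ Ico 0 s, x + t • θ ∈ Ω} :=
  ⟨Metric.diam Ω, fun _ hs => le_diam_of_mem hb hθ fun t ht => hs.2 t ⟨ht.1.le, ht.2⟩⟩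

theorem nonempty_delta (x : EuclideanSpace ℝ (Fin d)) :
    {s : ℝ | 0 ≤ s ∧ ∀ t ∈ Ico 0 s, x + t • θ ∈ Ω}.Nonempty :=
  ⟨0, le_refl _, fun _ h => absurd h.2 (not_lt.2 h.1)⟩

theorem delta_nonneg (x : EuclideanSpace ℝ (Fin d)) : 0 ≤ delta Ω θ x :=
  Real.sSup_nonneg fun _ hs => hs.1

theorem lowerSemicontinuous_delta (ho : IsOpen Ω) (hb : Bornology.IsBounded Ω) (hθ : ‖θ‖ = 1) :
    LowerSemicontinuous (delta Ω θ) := by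
  intro x l hl
  rcases lt_or_ge l 0 with h0 | h0
  · exact Eventually.of_forall fun x' => h0.trans_le (delta_nonneg x')
  · obtain ⟨s, hs, hls⟩ := exists_lt_of_lt_csSup (nonempty_delta x) hl
    obtain ⟨m, hm1, hm2⟩ := exists_between hls
    have : ∀ᶠ x' in 𝓝 x, ∀ t ∈ Icc 0 m, x' + t • θ ∈ Ω := by
      refine isCompact_Icc.eventually_forall_of_forall_eventually fun t ht => ?_
      have hc : Continuous fun p : EuclideanSpace ℝ (Fin d) × ℝ => p.1 + p.2 • θ := by fun_prop
      exact hc.continuousAt.eventually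
        (ho.mem_nhds (hs.2 t ⟨ht.1, ht.2.trans_lt hm2⟩))
    filter_upwards [this] with x' hx'
    exact hm1.trans_le (le_csSup (bddAbove_delta hb hθ x')
      ⟨h0.trans hm1.le, fun t ht => hx' t ⟨ht.1, ht.2.le⟩⟩)

theorem measurable_Phi (ho : IsOpen Ω) (hb : Bornology.IsBounded Ω) (hθ : ‖θ‖ = 1) :
    Measurable (Phi Ω θ) :=
  measurable_id.add ((lowerSemicontinuous_delta ho hb hθ).measurable.smul_const θ)

theorem dirMeasure_apply (ho : IsOpen Ω) (hb : Bornology.IsBounded Ω) (hθ : ‖θ‖ = 1)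
    {A : Set (EuclideanSpace ℝ (Fin d))} (hA : MeasurableSet A) :
    dirMeasure Ω θ A = ∫⁻ x in Ω, A.indicator 1 (Phi Ω θ x) := by
  rw [← lintegral_map (measurable_one.indicator hA) (measurable_Phi ho hb hθ),
    lintegral_indicator_one hA, dirMeasure]

theorem add_mem_of_lt_delta {x : EuclideanSpace ℝ (Fin d)} {t : ℝ} (h0 : 0 ≤ t)
    (ht : t < delta Ω θ x) : x + t • θ ∈ Ω := by
  obtain ⟨s, hs, hts⟩ := exists_lt_of_lt_csSup (nonempty_delta x) ht
  exact hs.2 t ⟨h0, hts⟩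

theorem add_delta_notMem (ho : IsOpen Ω) (hb : Bornology.IsBounded Ω) (hθ : ‖θ‖ = 1)
    (x : EuclideanSpace ℝ (Fin d)) : Phi Ω θ x ∉ Ω := by
  intro h
  have hc : Continuous fun t : ℝ => x + t • θ := by fun_prop
  obtain ⟨r, hr, hball⟩ := Metric.isOpen_iff.1 (ho.preimage hc) (delta Ω θ x) h
  have hle : delta Ω θ x + r / 2 ≤ delta Ω θ x := by
    refine le_csSup (bddAbove_delta hb hθ x) ⟨by linarith [delta_nonneg (Ω := Ω) (θ := θ) x], ?_⟩
    intro t ht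
    rcases lt_or_ge t (delta Ω θ x) with h1 | h1
    · exact add_mem_of_lt_delta ht.1 h1
    · refine hball ?_
      rw [Metric.mem_ball, Real.dist_eq, abs_of_nonneg (by linarith)]
      linarith [ht.2]
  linarith

/-- If `z = Φ_θ(x)` with `x ∈ Ω`, then `ℓ_{-θ}(z) = δ_θ(x) + δ_{-θ}(x)`. -/
theorem chordLength_Phi (ho : IsOpen Ω) (hb : Bornology.IsBounded Ω) (hθ : ‖θ‖ = 1)
    {x : EuclideanSpace ℝ (Fin d)} (hx : x ∈ Ω) :
    chordLength Ω θ (Phi Ω θ x) = delta Ω θ x + delta Ω (-θ) x := by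
  have e : ∀ t : ℝ, Phi Ω θ x - t • θ = x + (delta Ω θ x - t) • θ := fun t => by
    rw [Phi, sub_smul]; abel
  have e' : ∀ t : ℝ, Phi Ω θ x - t • θ = x + (t - delta Ω θ x) • (-θ) := fun t => by
    rw [e, smul_neg, ← neg_smul, neg_sub]
  have hpos : 0 < delta Ω θ x := by
    refine (delta_nonneg x).lt_of_ne fun h => add_delta_notMem ho hb hθ x ?_
    rw [Phi, ← h]; simpa using hx
  have hn := delta_nonneg (Ω := Ω) (θ := -θ) x
  refine IsGreatest.csSup_eq ⟨⟨by linarith, fun t ht => ?_⟩, fun s hs => ?_⟩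
  · rcases le_or_gt t (delta Ω θ x) with h | h
    · rw [e]; exact add_mem_of_lt_delta (by linarith) (by linarith [ht.1])
    · rw [e']; exact add_mem_of_lt_delta (by linarith) (by linarith [ht.2])
  · by_contra! h
    have := hs.2 (delta Ω θ x + delta Ω (-θ) x) ⟨by linarith, h⟩
    rw [e', add_sub_cancel_left] at this
    exact add_delta_notMem ho hb (by rwa [norm_neg]) x this

end

end DirTrace

/-!
On each line parallel to `θ`, a function of `W_θ(Ω)` agrees almost everywhere on every chord with a
primitive of `∂_θ u`, because `u(x + tθ) - u(x) = ∫₀ᵗ ∂_θ u(x + sθ) ds` for almost every `x` whose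
segment `[x, x + tθ]` lies in `Ω`. The end value of that primitive is the trace. By Cauchy–Schwarz
its squared distance to an average over length `m ≤ ε` before the end is at most `m` times the
energy of `∂_θ u` on the chord. The energy of a whole line is the same for `x` and `Φ_θ(x)`, so
integrating it against `μ_θ` amounts to integrating over `x ∈ Ω`, and by Tonelli each point of `Ω`
is counted with the length of a section of `Ω`, at most `diam Ω`.
-/

namespace DirTrace

noncomputable section

section Segments

variable {E : Type*} [NormedAddCommGroup E] [NormedSpace ℝ E] {Ω : Set E}

theorem isOpen_setOf_forall_add_smul_mem {K : Set ℝ} (hK : IsCompact K) (ho : IsOpen Ω) (θ : E) :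
    IsOpen {x | ∀ s ∈ K, x + s • θ ∈ Ω} := by
  refine isOpen_iff_eventually.2 fun x hx =>
    hK.eventually_forall_of_forall_eventually fun s hs => ?_
  have hcont : Continuous fun p : E × ℝ => p.1 + p.2 • θ := by fun_prop
  exact hcont.continuousAt.eventually (ho.mem_nhds (hx s hs))

theorem eventually_segment_subset_of_isCompact {K : Set E} (hK : IsCompact K) (ho : IsOpen Ω)
    (hKΩ : K ⊆ Ω) (θ : E) : ∀ᶠ t in 𝓝 (0 : ℝ), ∀ x ∈ K, ∀ s ∈ Icc 0 t, x + s • θ ∈ Ω := by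
  have hnear : ∀ᶠ s in 𝓝 (0 : ℝ), ∀ x ∈ K, x + s • θ ∈ Ω := by
    refine hK.eventually_forall_of_forall_eventually fun x hx => ?_
    have hcont : Continuous fun p : ℝ × E => p.2 + p.1 • θ := by fun_prop
    exact hcont.continuousAt.eventually (ho.mem_nhds (by simpa using hKΩ hx))
  obtain ⟨r, hr, hball⟩ := Metric.eventually_nhds_iff_ball.1 hnear
  filter_upwards [Iio_mem_nhds hr] with t ht x hx s hs
  refine hball s ?_ x hx
  rw [Metric.mem_ball, Real.dist_0_eq_abs, abs_of_nonneg hs.1]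
  exact hs.2.trans_lt ht

end Segments

section Translation

theorem integral_mul_comp_sub {G : Type*} [AddGroup G] [MeasurableSpace G] [MeasurableAdd G]
    {μ : Measure G} [μ.IsAddRightInvariant] (f g : G → ℝ) (a : G) :
    ∫ x, f x * g (x - a) ∂μ = ∫ x, g x * f (x + a) ∂μ := by
  rw [← integral_add_right_eq_self (fun x => f x * g (x - a)) a]
  simp only [add_sub_cancel_right, mul_comm]

theorem integral_indicator_mul {α : Type*} [MeasurableSpace α] {μ : Measure α} {s : Set α}
    (hs : MeasurableSet s) (f g : α → ℝ) :
    ∫ x, s.indicator f x * g x ∂μ = ∫ x in s, f x * g x ∂μ := by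
  rw [← integral_indicator hs]
  simp_rw [indicator_mul_left]

variable {E : Type*} [NormedAddCommGroup E] [MeasurableSpace E] [BorelSpace E]
  {μ : Measure E} {U V φ : E → ℝ}

theorem integrable_mul_comp_sub (hU : Integrable U μ) (hφ : Continuous φ)
    (hc : HasCompactSupport φ) (a : E) : Integrable (fun x => U x * φ (x - a)) μ := by
  obtain ⟨C, hC⟩ := hφ.bounded_above_of_compact_support hc
  exact hU.mul_bdd (c := C) (Continuous.aestronglyMeasurable (by fun_prop))
    (Eventually.of_forall fun x => hC _)

variable [NormedSpace ℝ E]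

theorem hasDerivAt_integral_mul_comp_sub (hU : Integrable U μ) (hφ : ContDiff ℝ 1 φ)
    (hc : HasCompactSupport φ) (θ : E) (t : ℝ) :
    HasDerivAt (fun t : ℝ => ∫ x, U x * φ (x - t • θ) ∂μ)
      (-∫ x, U x * fderiv ℝ φ (x - t • θ) θ ∂μ) t := by
  have hφ' : Continuous fun x => fderiv ℝ φ x θ :=
    (hφ.continuous_fderiv one_ne_zero).clm_apply continuous_const
  obtain ⟨C, hC⟩ := hφ'.bounded_above_of_compact_support (hc.fderiv_apply ℝ θ)
  have hder (x : E) (s : ℝ) :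
      HasDerivAt (fun t : ℝ => φ (x - t • θ)) (-fderiv ℝ φ (x - s • θ) θ) s := by
    have hline : HasDerivAt (fun t : ℝ => x - t • θ) (-θ) s := by
      simpa using ((hasDerivAt_id s).smul_const θ).const_sub x
    rw [← map_neg]
    exact (hφ.differentiable one_ne_zero (x - s • θ)).hasFDerivAt.comp_hasDerivAt s hline
  simp_rw [← integral_neg, ← mul_neg]
  refine (hasDerivAt_integral_of_dominated_loc_of_deriv_le (s := univ)
    (F := fun t x => U x * φ (x - t • θ)) (F' := fun t x => U x * -fderiv ℝ φ (x - t • θ) θ)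
    (bound := fun x => ‖U x‖ * C) univ_mem ?_ ?_ ?_ ?_ (hU.norm.mul_const C) ?_).2
  · exact Eventually.of_forall fun s =>
      (integrable_mul_comp_sub hU hφ.continuous hc _).aestronglyMeasurable
  · exact integrable_mul_comp_sub hU hφ.continuous hc _
  · exact hU.aestronglyMeasurable.mul
      (hφ'.comp (continuous_sub_right _)).neg.aestronglyMeasurable
  · refine Eventually.of_forall fun x s _ => ?_
    rw [norm_mul, norm_neg]
    exact mul_le_mul_of_nonneg_left (hC _) (norm_nonneg _)
  · exact Eventually.of_forall fun x s _ => (hder x s).const_mul (U x)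

theorem continuous_integral_mul_comp_sub (hU : Integrable U μ) (hφ : ContDiff ℝ 1 φ)
    (hc : HasCompactSupport φ) (θ : E) :
    Continuous fun t : ℝ => ∫ x, U x * φ (x - t • θ) ∂μ :=
  continuous_iff_continuousAt.2 fun t =>
    (hasDerivAt_integral_mul_comp_sub hU hφ hc θ t).continuousAt

variable [SecondCountableTopology E]

theorem measurePreserving_shear (ν : Measure ℝ) [SFinite ν] [SFinite μ] [μ.IsAddRightInvariant]
    (θ : E) :
    MeasurePreserving (fun p : ℝ × E => (p.1, p.2 + p.1 • θ)) (ν.prod μ) (ν.prod μ) :=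
  (MeasurePreserving.id ν).skew_product (g := fun s x => x + s • θ)
    (by simp only [Function.uncurry_def]; fun_prop)
    (Eventually.of_forall fun s => map_add_right_eq_self μ (s • θ))

variable [SFinite μ] [μ.IsAddRightInvariant]

theorem integrable_prod_comp_add_smul (ν : Measure ℝ) [IsFiniteMeasure ν] (hV : Integrable V μ)
    (θ : E) : Integrable (fun p : ℝ × E => V (p.2 + p.1 • θ)) (ν.prod μ) :=
  (measurePreserving_shear ν θ).integrable_comp_of_integrable (hV.comp_snd ν)

theorem integrable_intervalIntegral_comp_add_smul (hV : Integrable V μ) (θ : E) {t : ℝ}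
    (ht : 0 ≤ t) : Integrable (fun x => ∫ s in (0 : ℝ)..t, V (x + s • θ)) μ := by
  simp_rw [intervalIntegral.integral_of_le ht]
  exact (integrable_prod_comp_add_smul _ hV θ).integral_prod_right

theorem intervalIntegral_integral_mul_comp_sub (hV : Integrable V μ) (hφ : Continuous φ)
    (hc : HasCompactSupport φ) (θ : E) {t : ℝ} (ht : 0 ≤ t) :
    ∫ s in (0 : ℝ)..t, ∫ x, V x * φ (x - s • θ) ∂μ =
      ∫ x, φ x * (∫ s in (0 : ℝ)..t, V (x + s • θ)) ∂μ := by
  obtain ⟨C, hC⟩ := hφ.bounded_above_of_compact_support hc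
  simp_rw [integral_mul_comp_sub, intervalIntegral.integral_of_le ht]
  rw [integral_integral_swap]
  · simp_rw [integral_const_mul]
  · exact (integrable_prod_comp_add_smul (volume.restrict (Ioc 0 t)) hV θ).bdd_mul (c := C)
      (f := fun p => φ p.2)
      (hφ.comp continuous_snd).aestronglyMeasurable (Eventually.of_forall fun p => hC _)

theorem integral_mul_increment_sub_intervalIntegral (hU : Integrable U μ) (hV : Integrable V μ)
    (hφ : Continuous φ) (hc : HasCompactSupport φ) (θ : E) {t : ℝ} (ht : 0 ≤ t) :
    ∫ x, φ x * (U (x + t • θ) - U x - ∫ s in (0 : ℝ)..t, V (x + s • θ)) ∂μ =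
      (∫ x, U x * φ (x - t • θ) ∂μ) - (∫ x, U x * φ x ∂μ) -
        ∫ s in (0 : ℝ)..t, ∫ x, V x * φ (x - s • θ) ∂μ := by
  obtain ⟨C, hC⟩ := hφ.bounded_above_of_compact_support hc
  have hmul {f : E → ℝ} (hf : Integrable f μ) : Integrable (fun x => φ x * f x) μ :=
    hf.bdd_mul hφ.aestronglyMeasurable (Eventually.of_forall hC)
  have hUt := hmul (hU.comp_add_right (t • θ))
  have hV' := hmul (integrable_intervalIntegral_comp_add_smul hV θ ht)
  simp only [mul_sub]
  rw [integral_sub (f := fun x => φ x * U (x + t • θ) - φ x * U x) (hUt.sub (hmul hU)) hV',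
    integral_sub hUt (hmul hU), integral_mul_comp_sub,
    intervalIntegral_integral_mul_comp_sub hV hφ hc θ ht]
  simp_rw [mul_comm (φ _) (U _)]

end Translation

section Increments

variable {E : Type*} [NormedAddCommGroup E] [NormedSpace ℝ E] [MeasureSpace E]

/-- Integrated form of `∂_θ u = v`: the increment of `u` along almost every segment
`[x, x + t θ] ⊆ Ω` is the integral of `v` over it. Unlike the weak formulation, it can be restricted
to lines. -/
def AEIncrementEq (Ω : Set E) (θ : E) (t : ℝ) (u v : E → ℝ) : Prop :=
  ∀ᵐ x, (∀ s ∈ Icc 0 t, x + s • θ ∈ Ω) →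
    u (x + t • θ) - u x = ∫ s in (0 : ℝ)..t, v (x + s • θ)

variable {Ω : Set E} {θ : E} {u v : E → ℝ} {t : ℝ}

theorem aeIncrementEq_iff_indicator (ht : 0 ≤ t) :
    AEIncrementEq Ω θ t u v ↔ AEIncrementEq Ω θ t (Ω.indicator u) (Ω.indicator v) := by
  refine eventually_congr (Eventually.of_forall fun x => forall_congr' fun hx => ?_)
  have hx₀ : x ∈ Ω := by simpa using hx 0 ⟨le_rfl, ht⟩
  rw [indicator_of_mem (hx t ⟨ht, le_rfl⟩), indicator_of_mem hx₀]
  refine iff_of_eq (congrArg _ (intervalIntegral.integral_congr fun s hs => ?_))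
  rw [uIcc_of_le ht] at hs
  exact (indicator_of_mem (hx s hs) v).symm

variable [BorelSpace E]

theorem IsWeakDirDeriv.hasDerivAt_integral (ho : IsOpen Ω) (hu : IntegrableOn u Ω)
    (h : IsWeakDirDeriv Ω θ u v) {φ : E → ℝ} (hφ : ContDiff ℝ ∞ φ) (hc : HasCompactSupport φ)
    {s : ℝ} (hs : ∀ x ∈ tsupport φ, x + s • θ ∈ Ω) :
    HasDerivAt (fun t : ℝ => ∫ x, Ω.indicator u x * φ (x - t • θ))
      (∫ x, Ω.indicator v x * φ (x - s • θ)) s := by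
  have hc' : HasCompactSupport fun x => φ (x - s • θ) := by
    simpa [sub_eq_add_neg, Function.comp_def] using
      hc.comp_homeomorph (Homeomorph.addRight (-(s • θ)))
  have hsub : tsupport (fun x => φ (x - s • θ)) ⊆ Ω := fun x hx => by
    simpa using hs _ (tsupport_comp_subset_preimage (f := fun x => x - s • θ) φ (by fun_prop) hx)
  have hweak := h.2 (fun x => φ (x - s • θ)) (hφ.comp (contDiff_id.sub contDiff_const)) hc' hsub
  simp_rw [fderiv_comp_sub] at hweak
  convert hasDerivAt_integral_mul_comp_sub (hu.integrable_indicator ho.measurableSet)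
    (hφ.of_le (by simp)) hc θ s using 1
  rw [integral_indicator_mul ho.measurableSet, integral_indicator_mul ho.measurableSet]
  exact (neg_eq_iff_eq_neg.2 hweak).symm

theorem IsWeakDirDeriv.sum_smul [IsFiniteMeasureOnCompacts (volume : Measure E)] {ι : Type*}
    [Fintype ι] {e : ι → E} {w : ι → E → ℝ}
    (hu : MemLp u 2 (volume.restrict Ω)) (h : ∀ i, IsWeakDirDeriv Ω (e i) u (w i)) (c : ι → ℝ) :
    IsWeakDirDeriv Ω (∑ i, c i • e i) u fun x => ∑ i, c i * w i x := by
  refine ⟨memLp_finsetSum _ fun i _ => (h i).1.const_mul (c i), fun φ hφ hc hsupp => ?_⟩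
  have hleft (i : ι) : IntegrableOn (fun x => u x * fderiv ℝ φ x (e i)) Ω :=
    hu.integrable_mul (q := 2) (((hφ.continuous_fderiv (by simp)).clm_apply
      continuous_const).memLp_of_hasCompactSupport (hc.fderiv_apply ℝ (e i)))
  have hright (i : ι) : IntegrableOn (fun x => w i x * φ x) Ω :=
    (h i).1.integrable_mul (q := 2) (hφ.continuous.memLp_of_hasCompactSupport hc)
  simp only [map_sum, map_smul, smul_eq_mul, Finset.mul_sum, Finset.sum_mul, mul_left_comm (u _),
    mul_assoc]
  rw [integral_finsetSum _ fun i _ => (hleft i).const_mul (c i),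
    integral_finsetSum _ fun i _ => (hright i).const_mul (c i), ← Finset.sum_neg_distrib]
  simp_rw [integral_const_mul, (h _).2 φ hφ hc hsupp, mul_neg]

variable [FiniteDimensional ℝ E] [(volume : Measure E).IsAddHaarMeasure]

/-- Test functions are translated along `θ`: `t ↦ ∫ u φ(· - t θ)` has derivative
`∫ v φ(· - t θ)`. -/
theorem IsWeakDirDeriv.aeIncrementEq (ho : IsOpen Ω) (hu : IntegrableOn u Ω)
    (hv : IntegrableOn v Ω) (h : IsWeakDirDeriv Ω θ u v) (ht : 0 ≤ t) :
    AEIncrementEq Ω θ t u v := by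
  have hU := hu.integrable_indicator ho.measurableSet
  have hV := hv.integrable_indicator ho.measurableSet
  have hD := ((hU.comp_add_right (t • θ)).sub hU).sub
    (integrable_intervalIntegral_comp_add_smul hV θ ht)
  have hseg := isOpen_setOf_forall_add_smul_mem (isCompact_Icc (a := 0) (b := t)) ho θ
  have hzero := hseg.ae_eq_zero_of_integral_contDiff_smul_eq_zero
    (hD.locallyIntegrable.locallyIntegrableOn _) fun φ hφ hc hsupp => ?_
  · rw [aeIncrementEq_iff_indicator ht]
    filter_upwards [hzero] with x hx hxseg using sub_eq_zero.1 (hx hxseg)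
  have hftc := intervalIntegral.integral_eq_sub_of_hasDerivAt
    (fun s hs => h.hasDerivAt_integral ho hu hφ hc fun x hx =>
      hsupp hx s (uIcc_of_le ht ▸ hs))
    ((continuous_integral_mul_comp_sub hV (hφ.of_le (by simp)) hc θ).intervalIntegrable _ _)
  have hid := integral_mul_increment_sub_intervalIntegral hU hV hφ.continuous hc θ ht
  simp only [zero_smul, sub_zero] at hftc
  rwa [hftc, sub_self] at hid

theorem isWeakDirDeriv_of_aeIncrementEq (ho : IsOpen Ω) (hu : IntegrableOn u Ω)
    (hv : IntegrableOn v Ω) (hv₂ : MemLp v 2 (volume.restrict Ω)) {t : ℕ → ℝ}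
    (ht : ∀ n, 0 < t n) (ht₀ : Tendsto t atTop (𝓝 0)) (h : ∀ n, AEIncrementEq Ω θ (t n) u v) :
    IsWeakDirDeriv Ω θ u v := by
  refine ⟨hv₂, fun φ hφ hc hsupp => ?_⟩
  have hU := hu.integrable_indicator ho.measurableSet
  have hV := hv.integrable_indicator ho.measurableSet
  have hφ₁ : ContDiff ℝ 1 φ := hφ.of_le (by simp)
  have hderiv := (hasDerivAt_integral_mul_comp_sub hU hφ₁ hc θ 0).sub
    ((continuous_integral_mul_comp_sub hV hφ₁ hc θ).integral_hasStrictDerivAt 0 0).hasDerivAt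
  have hslope := (hasDerivAt_iff_tendsto_slope.1 hderiv).comp
    (tendsto_nhdsWithin_iff.2 ⟨ht₀, Eventually.of_forall fun n => (ht n).ne'⟩)
  have hvanish : ∀ᶠ n in atTop, ∫ x, φ x * (Ω.indicator u (x + t n • θ) - Ω.indicator u x -
      ∫ s in (0 : ℝ)..t n, Ω.indicator v (x + s • θ)) = 0 := by
    filter_upwards [ht₀.eventually (eventually_segment_subset_of_isCompact hc ho hsupp θ)]
      with n hn
    refine integral_eq_zero_of_ae ?_
    filter_upwards [(aeIncrementEq_iff_indicator (ht n).le).1 (h n)] with x hx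
    by_cases hxφ : x ∈ tsupport φ
    · simp [hx (hn x hxφ)]
    · simp [image_eq_zero_of_notMem_tsupport hxφ]
  have hlim := tendsto_nhds_unique hslope (tendsto_const_nhds.congr' (f₁ := fun _ => (0 : ℝ)) ?_)
  · simp only [zero_smul, sub_zero, integral_indicator_mul ho.measurableSet] at hlim
    linarith
  filter_upwards [hvanish] with n hn
  rw [integral_mul_increment_sub_intervalIntegral hU hV hφ.continuous hc θ (ht n).le] at hn
  simp only [Function.comp_apply, slope_def_field, Pi.sub_apply, zero_smul, sub_zero,
    intervalIntegral.integral_same]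
  rw [sub_right_comm, hn, zero_div]

end Increments

section Line

theorem exists_ae_eq_const_of_ae_add_eq {G : Type*} [AddCommGroup G] [MeasurableSpace G]
    [MeasurableAdd₂ G] {μ : Measure G} [SFinite μ] [μ.IsAddLeftInvariant] {I : Set G}
    (hI : MeasurableSet I) {H : G → ℝ} (hH : AEMeasurable H (μ.restrict I))
    (h : ∀ t, ∀ᵐ s ∂μ, s ∈ I → s + t ∈ I → H (s + t) = H s) :
    ∃ c, ∀ᵐ s ∂μ.restrict I, H s = c := by
  obtain ⟨H', hH', hHH'⟩ := hH
  rw [EventuallyEq, ae_restrict_iff' hI] at hHH'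
  have hadd (t : G) : ∀ᵐ s ∂μ, s ∈ I → s + t ∈ I → H' (s + t) = H' s := by
    filter_upwards [h t, hHH', (eventually_add_right_iff μ t).2 hHH'] with s hs hs₁ hs₂ hsI hstI
    rw [← hs₁ hsI, ← hs₂ hstI, hs hsI hstI]
  have hmeas : MeasurableSet {p : G × G | p.2 ∈ I → p.2 + p.1 ∈ I → H' (p.2 + p.1) = H' p.2} :=
    (measurable_snd hI).imp <| ((measurable_snd.add measurable_fst) hI).imp <|
      measurableSet_eq_fun (hH'.comp (measurable_snd.add measurable_fst)) (hH'.comp measurable_snd)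
  have hadd' := (Measure.ae_ae_comm (μ := μ) (ν := μ) hmeas).1 (Eventually.of_forall hadd)
  by_cases hex : ∃ s ∈ I, ∀ᵐ t ∂μ, s ∈ I → s + t ∈ I → H' (s + t) = H' s
  · obtain ⟨s, hsI, hs⟩ := hex
    refine ⟨H' s, (ae_restrict_iff' hI).2 ?_⟩
    have hs' := (eventually_add_left_iff μ s (p := fun r => s ∈ I → r ∈ I → H' r = H' s)).1 hs
    filter_upwards [hs', hHH'] with r hr hr' hrI
    rw [hr' hrI, hr hsI hrI]
  · refine ⟨0, (ae_restrict_iff' hI).2 ?_⟩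
    filter_upwards [hadd'] with s hs hsI using (hex ⟨s, hsI, hs⟩).elim

theorem sq_intervalIntegral_le {V : ℝ → ℝ} {a b : ℝ} (hab : a ≤ b)
    (hV : MemLp V 2 (volume.restrict (Ioc a b))) :
    (∫ x in a..b, V x) ^ 2 ≤ (b - a) * ∫ x in a..b, V x ^ 2 := by
  obtain rfl | hab := hab.eq_or_lt
  · simp
  have hba : 0 < b - a := sub_pos.2 hab
  have hjensen := even_two.convexOn_pow.map_set_average_le (t := Ioc a b) (μ := volume)
    (continuous_pow 2).continuousOn isClosed_univ (by simpa using hab) (by simp) (by simp)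
    (hV.integrable one_le_two) hV.integrable_sq
  simp only [setAverage_eq, Real.volume_real_Ioc_of_le hab.le, smul_eq_mul, mul_pow] at hjensen
  rw [intervalIntegral.integral_of_le hab.le, intervalIntegral.integral_of_le hab.le]
  calc (∫ x in Ioc a b, V x) ^ 2
      = (b - a) ^ 2 * ((b - a)⁻¹ ^ 2 * (∫ x in Ioc a b, V x) ^ 2) := by field_simp
    _ ≤ (b - a) ^ 2 * ((b - a)⁻¹ * ∫ x in Ioc a b, V x ^ 2) := by gcongr
    _ = (b - a) * ∫ x in Ioc a b, V x ^ 2 := by field_simp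

variable {U V : ℝ → ℝ} {α β c : ℝ}

theorem exists_ae_eq_sub_intervalIntegral (hU : MemLp U 2 (volume.restrict (Ioo α β)))
    (h : IsWeakDirDeriv (Ioo α β) 1 U V) :
    ∃ c, ∀ᵐ r ∂volume.restrict (Ioo α β), U r = c - ∫ x in r..β, V x := by
  have hV : IntegrableOn V (Icc α β) :=
    (integrableOn_Icc_iff_integrableOn_Ioo).2 (h.1.integrable one_le_two)
  have hVint {a b : ℝ} (ha : a ∈ Icc α β) (hb : b ∈ Icc α β) : IntervalIntegrable V volume a b :=
    (hV.mono_set (uIcc_subset_Icc ha hb)).intervalIntegrable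
  have hpos {t : ℝ} (ht : 0 ≤ t) : ∀ᵐ s, s ∈ Ioo α β → s + t ∈ Ioo α β →
      U (s + t) + ∫ x in (s + t)..β, V x = U s + ∫ x in s..β, V x := by
    filter_upwards [h.aeIncrementEq isOpen_Ioo (hU.integrable one_le_two)
      (h.1.integrable one_le_two) ht] with s hs hsI hstI
    have hinc := hs fun r hr => ⟨by simpa using hsI.1.trans_le (le_add_of_nonneg_right hr.1),
      by simpa using (add_le_add_right hr.2 s).trans_lt hstI.2⟩
    simp only [smul_eq_mul, mul_one, intervalIntegral.integral_comp_add_left, add_zero] at hinc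
    have hadj := intervalIntegral.integral_add_adjacent_intervals
      (hVint (Ioo_subset_Icc_self hsI) (Ioo_subset_Icc_self hstI))
      (hVint (Ioo_subset_Icc_self hstI) (right_mem_Icc.2 (hsI.1.trans hsI.2).le))
    linarith
  suffices hconst : ∃ c, ∀ᵐ r ∂volume.restrict (Ioo α β), U r + ∫ x in r..β, V x = c from
    hconst.imp fun c hc => hc.mono fun r hr => eq_sub_of_add_eq hr
  refine exists_ae_eq_const_of_ae_add_eq measurableSet_Ioo ?_ fun t => ?_
  · refine hU.aestronglyMeasurable.aemeasurable.add ?_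
    obtain hαβ | hβα := le_or_gt α β
    · refine ContinuousOn.aemeasurable ?_ measurableSet_Ioo
      rw [← uIcc_of_le hαβ] at hV
      exact (intervalIntegral.continuousOn_primitive_interval_left hV).mono
        (Ioo_subset_Icc_self.trans Icc_subset_uIcc)
    · simp [Ioo_eq_empty hβα.not_gt]
  · obtain ht | ht := le_total 0 t
    · exact hpos ht
    · filter_upwards [(eventually_add_right_iff volume t).2 (hpos (neg_nonneg.2 ht))]
        with s hs hsI hstI
      simpa using (hs hstI (by simpa using hsI)).symm

/-- `c` is the value at `β` of the representative of `U` on `]α, β[` that is continuous on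
`]α, β]`. -/
def IsEndpointValue (U : ℝ → ℝ) (α β c : ℝ) : Prop :=
  ∃ f : ℝ → ℝ, f =ᵐ[volume.restrict (Ioo α β)] U ∧ ContinuousOn f (Ioc α β) ∧ c = f β

theorem isEndpointValue_of_ae_eq_sub_intervalIntegral (hαβ : α ≤ β)
    (hV : IntegrableOn V (Ioo α β))
    (hc : ∀ᵐ r ∂volume.restrict (Ioo α β), U r = c - ∫ x in r..β, V x) :
    IsEndpointValue U α β c := by
  refine ⟨fun r => c - ∫ x in r..β, V x, hc.mono fun r hr => hr.symm, ?_, by simp⟩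
  rw [← integrableOn_Icc_iff_integrableOn_Ioo, ← uIcc_of_le hαβ] at hV
  exact continuousOn_const.sub ((intervalIntegral.continuousOn_primitive_interval_left hV).mono
    (Ioc_subset_Icc_self.trans Icc_subset_uIcc))

theorem IsEndpointValue.unique {c' : ℝ} (hαβ : α < β) (hc : IsEndpointValue U α β c)
    (hc' : IsEndpointValue U α β c') : c = c' := by
  obtain ⟨f, hf, hf_cont, rfl⟩ := hc
  obtain ⟨g, hg, hg_cont, rfl⟩ := hc'
  refine Measure.eqOn_Ioc_of_ae_eq volume ?_ hf_cont hg_cont (right_mem_Ioc.2 hαβ)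
  rw [Measure.restrict_congr_set Ioo_ae_eq_Ioc.symm]
  exact hf.trans hg.symm

theorem exists_isEndpointValue (hαβ : α ≤ β) (hU : MemLp U 2 (volume.restrict (Ioo α β)))
    (h : IsWeakDirDeriv (Ioo α β) 1 U V) : ∃ c, IsEndpointValue U α β c :=
  (exists_ae_eq_sub_intervalIntegral hU h).imp fun _ =>
    isEndpointValue_of_ae_eq_sub_intervalIntegral hαβ (h.1.integrable one_le_two)

theorem IsEndpointValue.ae_eq_sub_intervalIntegral (hc : IsEndpointValue U α β c) (hαβ : α < β)
    (hU : MemLp U 2 (volume.restrict (Ioo α β))) (h : IsWeakDirDeriv (Ioo α β) 1 U V) :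
    ∀ᵐ r ∂volume.restrict (Ioo α β), U r = c - ∫ x in r..β, V x := by
  obtain ⟨c', hc'⟩ := exists_ae_eq_sub_intervalIntegral hU h
  rwa [hc.unique hαβ (isEndpointValue_of_ae_eq_sub_intervalIntegral hαβ.le
    (h.1.integrable one_le_two) hc')]

theorem intervalIntegrable_comp_sub_left_of_memLp (hαβ : α ≤ β)
    (hU : MemLp U 2 (volume.restrict (Ioo α β))) :
    IntervalIntegrable (fun s => U (β - s)) volume 0 (β - α) := by
  have hint : IntervalIntegrable U volume α β :=
    (intervalIntegrable_iff_integrableOn_Ioo_of_le hαβ).2 (hU.integrable one_le_two)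
  simpa using (hint.comp_sub_left β).symm

theorem ae_sq_sub_le_of_ae_eq_sub_intervalIntegral (hV : MemLp V 2 (volume.restrict (Ioo α β)))
    (hc : ∀ᵐ r ∂volume.restrict (Ioo α β), U r = c - ∫ x in r..β, V x) :
    ∀ᵐ r, r ∈ Ioo α β → (c - U r) ^ 2 ≤ (β - r) * ∫ x in Ioo α β, V x ^ 2 := by
  filter_upwards [(ae_restrict_iff' measurableSet_Ioo).1 hc] with r hr hrI
  have hsub : Ioc r β ≤ᵐ[volume] Ioo α β :=
    Ioo_ae_eq_Ioc.symm.le.trans (Ioo_subset_Ioo_left hrI.1.le).eventuallyLE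
  have hV' : MemLp V 2 (volume.restrict (Ioc r β)) :=
    hV.mono_measure (Measure.restrict_mono' hsub le_rfl)
  rw [hr hrI, sub_sub_cancel]
  refine (sq_intervalIntegral_le hrI.2.le hV').trans
    (mul_le_mul_of_nonneg_left ?_ (sub_nonneg.2 hrI.2.le))
  rw [intervalIntegral.integral_of_le hrI.2.le]
  exact setIntegral_mono_set hV.integrable_sq (Eventually.of_forall fun x => sq_nonneg _) hsub

theorem abs_sub_average_le {F : ℝ → ℝ} {m C : ℝ} (hm : 0 < m)
    (hF : IntervalIntegrable F volume 0 m) (hC : ∀ᵐ s, s ∈ Ioc 0 m → |c - F s| ≤ C) :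
    |c - 1 / m * ∫ s in (0 : ℝ)..m, F s| ≤ C := by
  have hdiff : c - 1 / m * ∫ s in (0 : ℝ)..m, F s = (∫ s in (0 : ℝ)..m, (c - F s)) / m := by
    rw [intervalIntegral.integral_sub intervalIntegrable_const hF,
      intervalIntegral.integral_const, sub_zero, smul_eq_mul]
    field_simp
  rw [← uIoc_of_le hm.le] at hC
  rw [hdiff, abs_div, abs_of_pos hm, div_le_iff₀ hm]
  simpa [abs_of_pos hm] using intervalIntegral.norm_integral_le_of_norm_le_const_ae
    (f := fun s => c - F s) hC

theorem IsEndpointValue.sq_sub_average_le (hc : IsEndpointValue U α β c)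
    (hU : MemLp U 2 (volume.restrict (Ioo α β))) (h : IsWeakDirDeriv (Ioo α β) 1 U V) {m : ℝ}
    (hm : 0 < m) (hmβ : m ≤ β - α) :
    (c - 1 / m * ∫ s in (0 : ℝ)..m, U (β - s)) ^ 2 ≤ m * ∫ x in Ioo α β, V x ^ 2 := by
  set K := ∫ x in Ioo α β, V x ^ 2
  have hK : 0 ≤ K := integral_nonneg fun x => sq_nonneg _
  have hαβ : α < β := by linarith
  have hclose : ∀ᵐ s, s ∈ Ioc 0 m → |c - U (β - s)| ≤ √(m * K) := by
    filter_upwards [(quasiMeasurePreserving_sub_left volume β).ae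
      (ae_sq_sub_le_of_ae_eq_sub_intervalIntegral h.1 (hc.ae_eq_sub_intervalIntegral hαβ hU h)),
      Measure.ae_ne volume m] with s hs hsm hs_mem
    have hsm' : s < m := hs_mem.2.lt_of_ne hsm
    refine Real.abs_le_sqrt ((hs ⟨by linarith, by linarith [hs_mem.1]⟩).trans ?_)
    rw [sub_sub_cancel]
    exact mul_le_mul_of_nonneg_right hs_mem.2 hK
  have hUint : IntervalIntegrable (fun s => U (β - s)) volume 0 m :=
    (intervalIntegrable_comp_sub_left_of_memLp hαβ.le hU).mono_set
      (uIcc_subset_uIcc_left (uIcc_of_le (hm.le.trans hmβ) ▸ ⟨hm.le, hmβ⟩))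
  rw [← sq_abs, ← Real.sq_sqrt (mul_nonneg hm.le hK)]
  exact pow_le_pow_left₀ (abs_nonneg _) (abs_sub_average_le hm hUint hclose) 2

end Line

section Chords

variable {d : ℕ} {Ω : Set (EuclideanSpace ℝ (Fin d))} {θ y z : EuclideanSpace ℝ (Fin d)}
  {α β s : ℝ}

theorem isOpen_slice (ho : IsOpen Ω) (θ y : EuclideanSpace ℝ (Fin d)) : IsOpen (slice Ω θ y) :=
  ho.preimage (by fun_prop : Continuous fun s : ℝ => s • θ + y)

theorem volume_slice_le (hb : Bornology.IsBounded Ω) (hθ : ‖θ‖ = 1)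
    (y : EuclideanSpace ℝ (Fin d)) :
    volume (slice Ω θ y) ≤ ENNReal.ofReal (Metric.diam Ω) := by
  refine (Real.volume_le_diam _).trans (Metric.ediam_le fun s hs t ht => ?_)
  rw [edist_dist]
  have hst := Metric.dist_le_diam_of_mem hb hs ht
  rw [dist_add_right, dist_eq_norm, ← sub_smul, norm_smul, hθ, mul_one, ← dist_eq_norm] at hst
  exact ENNReal.ofReal_le_ofReal hst

theorem isComponentInterval_slice (ho : IsOpen Ω) (hb : Bornology.IsBounded Ω) (hθ : ‖θ‖ = 1)
    (hs : s • θ + y ∈ Ω) :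
    IsComponentInterval (slice Ω θ y) (s - delta Ω (-θ) (s • θ + y))
      (s + delta Ω θ (s • θ + y)) := by
  set x := s • θ + y
  have hθ' : ‖-θ‖ = 1 := by rwa [norm_neg]
  have hfwd (t : ℝ) : (s + t) • θ + y = x + t • θ := by module
  have hbwd (t : ℝ) : (s - t) • θ + y = x + t • -θ := by module
  have hβ : s + delta Ω θ x ∉ slice Ω θ y := fun h =>
    add_delta_notMem ho hb hθ x (by rwa [slice, mem_ofPred_eq, hfwd] at h)
  have hα : s - delta Ω (-θ) x ∉ slice Ω θ y := fun h =>
    add_delta_notMem ho hb hθ' x (by rwa [slice, mem_ofPred_eq, hbwd] at h)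
  have hpos : 0 < delta Ω θ x := (delta_nonneg x).lt_of_ne fun h => hβ (by rwa [← h, add_zero])
  refine ⟨by linarith [delta_nonneg (Ω := Ω) (θ := -θ) x], fun r hr => ?_, hα, hβ⟩
  rcases le_total s r with hsr | hrs
  · rw [slice, mem_ofPred_eq, ← add_sub_cancel s r, hfwd]
    exact add_mem_of_lt_delta (by linarith) (by linarith [hr.2])
  · rw [slice, mem_ofPred_eq, ← sub_sub_cancel s r, hbwd]
    exact add_mem_of_lt_delta (by linarith) (by linarith [hr.1])

theorem delta_of_isComponentInterval (hc : IsComponentInterval (slice Ω θ y) α β)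
    (hs : s ∈ Ioo α β) : delta Ω θ (s • θ + y) = β - s := by
  have hadd (t : ℝ) : s • θ + y + t • θ = (s + t) • θ + y := by module
  refine IsGreatest.csSup_eq ⟨⟨by linarith [hs.2], fun t ht => ?_⟩, fun r hr => ?_⟩
  · rw [hadd]
    exact hc.2.1 ⟨by linarith [hs.1, ht.1], by linarith [ht.2]⟩
  · by_contra! hlt
    have hmem := hr.2 (β - s) ⟨by linarith [hs.2], hlt⟩
    rw [hadd, add_sub_cancel] at hmem
    exact hc.2.2.2 hmem

theorem chordLength_of_isComponentInterval (hc : IsComponentInterval (slice Ω θ y) α β) :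
    chordLength Ω θ (β • θ + y) = β - α := by
  have hsub (t : ℝ) : β • θ + y - t • θ = (β - t) • θ + y := by module
  refine IsGreatest.csSup_eq ⟨⟨by linarith [hc.1], fun t ht => ?_⟩, fun r hr => ?_⟩
  · rw [hsub]
    exact hc.2.1 ⟨by linarith [ht.2], by linarith [ht.1]⟩
  · by_contra! hlt
    have hmem := hr.2 (β - α) ⟨by linarith [hc.1], hlt⟩
    rw [hsub, sub_sub_cancel] at hmem
    exact hc.2.2.1 hmem

theorem mem_dirBoundary_iff (ho : IsOpen Ω) (hb : Bornology.IsBounded Ω) (hθ : ‖θ‖ = 1) :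
    β • θ + y ∈ dirBoundary Ω θ ↔ ∃ α, IsComponentInterval (slice Ω θ y) α β := by
  constructor
  · rintro ⟨x, hx, hxβ⟩
    have hxy : (β - delta Ω θ x) • θ + y = x := by
      rw [sub_smul, sub_add_eq_add_sub, ← hxβ, Phi, add_sub_cancel_right]
    have hc := isComponentInterval_slice ho hb hθ (hxy ▸ hx)
    rw [hxy, sub_add_cancel] at hc
    exact ⟨_, hc⟩
  · rintro ⟨α, hc⟩
    have hmid : (α + β) / 2 ∈ Ioo α β := ⟨by linarith [hc.1], by linarith [hc.1]⟩
    refine ⟨((α + β) / 2) • θ + y, hc.2.1 hmid, ?_⟩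
    rw [Phi, delta_of_isComponentInterval hc hmid]
    module

theorem chordLength_nonneg (θ z : EuclideanSpace ℝ (Fin d)) : 0 ≤ chordLength Ω θ z :=
  Real.sSup_nonneg fun _ hs => hs.1

theorem lt_chordLength_iff (hb : Bornology.IsBounded Ω) (hθ : ‖θ‖ = 1) (hs : 0 ≤ s) :
    s < chordLength Ω θ z ↔ ∃ q : ℚ, s < q ∧ ∀ t ∈ Ioo (0 : ℝ) q, z - t • θ ∈ Ω := by
  constructor
  · intro h
    have hne : {s : ℝ | 0 ≤ s ∧ ∀ t ∈ Ioo 0 s, z - t • θ ∈ Ω}.Nonempty :=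
      ⟨0, by simp +contextual [lt_asymm]⟩
    obtain ⟨r, hr, hsr⟩ := exists_lt_of_lt_csSup hne h
    obtain ⟨q, hsq, hqr⟩ := exists_rat_btwn hsr
    exact ⟨q, hsq, fun t ht => hr.2 t ⟨ht.1, ht.2.trans hqr⟩⟩
  · rintro ⟨q, hsq, hq⟩
    have hbdd : BddAbove {s : ℝ | 0 ≤ s ∧ ∀ t ∈ Ioo 0 s, z - t • θ ∈ Ω} :=
      ⟨Metric.diam Ω, fun r hr => le_diam_of_mem (θ := -θ) (x := z) hb (by rwa [norm_neg])
        fun t ht => by simpa [sub_eq_add_neg] using hr.2 t ht⟩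
    exact hsq.trans_le (le_csSup hbdd ⟨hs.trans hsq.le, hq⟩)

theorem measurableSet_setOf_forall_Ioo_sub_smul_mem (ho : IsOpen Ω)
    (θ : EuclideanSpace ℝ (Fin d)) (s : ℝ) :
    MeasurableSet {z | ∀ t ∈ Ioo 0 s, z - t • θ ∈ Ω} := by
  have hcover : Ioo 0 s = ⋃ n : ℕ, Icc (1 / ((n : ℝ) + 1)) (s - 1 / ((n : ℝ) + 1)) := by
    ext t
    simp only [mem_iUnion]
    constructor
    · intro ht
      obtain ⟨n, hn⟩ := exists_nat_one_div_lt (lt_min ht.1 (sub_pos.2 ht.2))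
      exact ⟨n, (hn.trans_le (min_le_left _ _)).le,
        by linarith [hn.trans_le (min_le_right _ _)]⟩
    · rintro ⟨n, hn⟩
      have hpos : (0 : ℝ) < 1 / ((n : ℝ) + 1) := by positivity
      exact ⟨by linarith [hn.1], by linarith [hn.2]⟩
  simp only [hcover, mem_iUnion, forall_exists_index, @forall_comm ℝ ℕ, ofPred_forall]
  refine MeasurableSet.iInter fun n => ?_
  simpa only [smul_neg, ← sub_eq_add_neg, ofPred_forall] using
    (isOpen_setOf_forall_add_smul_mem (isCompact_Icc (a := 1 / ((n : ℝ) + 1))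
      (b := s - 1 / ((n : ℝ) + 1))) ho (-θ)).measurableSet

theorem measurable_chordLength (ho : IsOpen Ω) (hb : Bornology.IsBounded Ω) (hθ : ‖θ‖ = 1) :
    Measurable (chordLength Ω θ) := by
  refine measurable_of_Ioi fun c => ?_
  rcases lt_or_ge c 0 with hc | hc
  · rw [eq_univ_of_forall (s := chordLength Ω θ ⁻¹' Ioi c) fun z =>
      hc.trans_le (chordLength_nonneg θ z)]
    exact MeasurableSet.univ
  · have hunion : chordLength Ω θ ⁻¹' Ioi c =
        ⋃ q : ℚ, ⋃ _ : c < q, {z | ∀ t ∈ Ioo (0 : ℝ) q, z - t • θ ∈ Ω} := by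
      ext z
      simp only [mem_preimage, mem_Ioi, lt_chordLength_iff hb hθ hc, mem_iUnion, mem_ofPred_eq,
        exists_prop]
    rw [hunion]
    exact MeasurableSet.iUnion fun q => MeasurableSet.iUnion fun _ =>
      measurableSet_setOf_forall_Ioo_sub_smul_mem ho θ q

theorem dirBoundary_eq (ho : IsOpen Ω) (hb : Bornology.IsBounded Ω) (hθ : ‖θ‖ = 1) :
    dirBoundary Ω θ = Ωᶜ ∩ chordLength Ω θ ⁻¹' Ioi 0 := by
  ext z
  have hz : (0 : ℝ) • θ + z = z := by simp
  rw [← hz, mem_dirBoundary_iff ho hb hθ]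
  constructor
  · rintro ⟨α, hc⟩
    exact ⟨hc.2.2.2, by
      rw [mem_preimage, chordLength_of_isComponentInterval hc]; exact sub_pos.2 hc.1⟩
  · rintro ⟨hzΩ, hlen⟩
    obtain ⟨q, hq₀, hq⟩ := (lt_chordLength_iff hb hθ le_rfl).1 hlen
    have hmem : ∀ t ∈ Ioo (0 : ℝ) q, -t ∈ slice Ω θ z := fun t ht => by
      simpa [slice, sub_eq_neg_add] using hq t ht
    have hhalf : (q / 2 : ℝ) ∈ Ioo (0 : ℝ) q := ⟨by linarith, by linarith⟩
    have hc := isComponentInterval_slice ho hb hθ (hmem _ hhalf)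
    set δ := delta Ω θ (-(q / 2 : ℝ) • θ + z)
    suffices hδ : -(q / 2 : ℝ) + δ = 0 from ⟨_, hδ ▸ hc⟩
    refine le_antisymm (not_lt.1 fun hlt => hzΩ (hc.2.1 ⟨?_, hlt⟩)) (not_lt.1 fun hlt => ?_)
    · linarith [delta_nonneg (Ω := Ω) (θ := -θ) (-(q / 2 : ℝ) • θ + z)]
    · refine hc.2.2.2 (neg_neg (-(q / 2 : ℝ) + δ) ▸ hmem _ ⟨by linarith, ?_⟩)
      linarith [delta_nonneg (Ω := Ω) (θ := θ) (-(q / 2 : ℝ) • θ + z)]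

theorem measurableSet_dirBoundary (ho : IsOpen Ω) (hb : Bornology.IsBounded Ω) (hθ : ‖θ‖ = 1) :
    MeasurableSet (dirBoundary Ω θ) := by
  rw [dirBoundary_eq ho hb hθ]
  exact ho.measurableSet.compl.inter (measurable_chordLength ho hb hθ measurableSet_Ioi)

theorem ae_mem_dirBoundary (ho : IsOpen Ω) (hb : Bornology.IsBounded Ω) (hθ : ‖θ‖ = 1) :
    ∀ᵐ z ∂(dirMeasure Ω θ), z ∈ dirBoundary Ω θ :=
  (ae_map_iff (measurable_Phi ho hb hθ).aemeasurable (measurableSet_dirBoundary ho hb hθ)).2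
    ((ae_restrict_mem ho.measurableSet).mono fun _ => mem_image_of_mem _)

end Chords

section Lines

variable {d : ℕ} {Ω : Set (EuclideanSpace ℝ (Fin d))} {θ : EuclideanSpace ℝ (Fin d)}
  {u v : EuclideanSpace ℝ (Fin d) → ℝ}

instance : (hypMeasure θ).IsAddHaarMeasure := by
  rw [hypMeasure]
  infer_instance

theorem hypMeasure_eq_volume (θ : EuclideanSpace ℝ (Fin d)) : hypMeasure θ = volume :=
  (stdOrthonormalBasis ℝ (hyp θ)).addHaar_eq_volume

theorem measurePreserving_measurableEquivProd_span (θ : EuclideanSpace ℝ (Fin d)) :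
    MeasurePreserving ((Submodule.span ℝ {θ}).measurableEquivProd (0 : EuclideanSpace ℝ (Fin d)))
      volume (volume.prod (hypMeasure θ)) := by
  rw [hypMeasure_eq_volume, ← InnerProductSpace.euclideanHausdorffMeasure_eq_volume]
  exact (Submodule.span ℝ {θ}).measurePreserving_measurableEquivProd 0

theorem measurePreserving_line (hθ : ‖θ‖ = 1) :
    MeasurePreserving (fun p : hyp θ × ℝ => p.2 • θ + (p.1 : EuclideanSpace ℝ (Fin d)))
      ((hypMeasure θ).prod volume) volume := by
  have hspan := (LinearIsometryEquiv.toSpanUnitSingleton (𝕜 := ℝ) θ hθ).measurePreserving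
  convert (measurePreserving_measurableEquivProd_span θ).symm.comp
    ((hspan.prod (MeasurePreserving.id (hypMeasure θ))).comp Measure.measurePreserving_swap) using 1
  ext1 p
  simp

theorem ae_ae_line (hθ : ‖θ‖ = 1) {p : EuclideanSpace ℝ (Fin d) → Prop} (h : ∀ᵐ x, p x) :
    ∀ᵐ y : hyp θ ∂(hypMeasure θ), ∀ᵐ s : ℝ, p (s • θ + y) :=
  Measure.ae_ae_of_ae_prod ((measurePreserving_line hθ).quasiMeasurePreserving.ae h)

theorem ae_ae_slice (ho : IsOpen Ω) (hθ : ‖θ‖ = 1) {p : EuclideanSpace ℝ (Fin d) → Prop}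
    (h : ∀ᵐ x ∂(volume.restrict Ω), p x) :
    ∀ᵐ y : hyp θ ∂(hypMeasure θ), ∀ᵐ s ∂(volume.restrict (slice Ω θ y)), p (s • θ + y) :=
  (ae_ae_line hθ ((ae_restrict_iff' ho.measurableSet).1 h)).mono fun y hy =>
    (ae_restrict_iff' (isOpen_slice ho θ y).measurableSet).2 hy

theorem quasiMeasurePreserving_orthogonalProjectionOnto_hyp (θ : EuclideanSpace ℝ (Fin d)) :
    Measure.QuasiMeasurePreserving (hyp θ).orthogonalProjectionOnto volume (hypMeasure θ) := by
  convert Measure.quasiMeasurePreserving_snd.comp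
    (measurePreserving_measurableEquivProd_span θ).quasiMeasurePreserving using 1
  ext1 x
  simp

theorem inner_smul_add_orthogonalProjectionOnto_hyp (hθ : ‖θ‖ = 1)
    (x : EuclideanSpace ℝ (Fin d)) :
    ⟪θ, x⟫ • θ + ((hyp θ).orthogonalProjectionOnto x : EuclideanSpace ℝ (Fin d)) = x := by
  rw [← Submodule.starProjection_unit_singleton ℝ hθ]
  exact Submodule.starProjection_add_starProjection_orthogonal _

theorem quasiMeasurePreserving_orthogonalProjectionOnto_hyp_dirMeasure (ho : IsOpen Ω)
    (hb : Bornology.IsBounded Ω) (hθ : ‖θ‖ = 1) :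
    Measure.QuasiMeasurePreserving (hyp θ).orthogonalProjectionOnto (dirMeasure Ω θ)
      (hypMeasure θ) := by
  have hproj := quasiMeasurePreserving_orthogonalProjectionOnto_hyp θ
  refine ⟨hproj.measurable, ?_⟩
  have hΦ : (hyp θ).orthogonalProjectionOnto ∘ Phi Ω θ = (hyp θ).orthogonalProjectionOnto := by
    ext1 x
    simp [Phi, Submodule.orthogonalProjectionOnto_orthogonalComplement_singleton_eq_zero]
  rw [dirMeasure, Measure.map_map hproj.measurable (measurable_Phi ho hb hθ), hΦ]
  exact (hproj.mono_left Measure.restrict_le_self.absolutelyContinuous).absolutelyContinuous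

theorem ae_dirMeasure_of_ae_hypMeasure (ho : IsOpen Ω) (hb : Bornology.IsBounded Ω)
    (hθ : ‖θ‖ = 1) {p : EuclideanSpace ℝ (Fin d) → Prop}
    (h : ∀ᵐ y : hyp θ ∂(hypMeasure θ), ∀ α β : ℝ, IsComponentInterval (slice Ω θ y) α β →
      p (β • θ + y)) :
    ∀ᵐ z ∂(dirMeasure Ω θ), p z := by
  filter_upwards [ae_mem_dirBoundary ho hb hθ,
    (quasiMeasurePreserving_orthogonalProjectionOnto_hyp_dirMeasure ho hb hθ).ae h] with z hz hp
  rw [← inner_smul_add_orthogonalProjectionOnto_hyp hθ z] at hz ⊢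
  obtain ⟨α, hc⟩ := (mem_dirBoundary_iff ho hb hθ).1 hz
  exact hp α _ hc

theorem ae_memLp_slice (ho : IsOpen Ω) (hθ : ‖θ‖ = 1) (hu : MemLp u 2 (volume.restrict Ω)) :
    ∀ᵐ y : hyp θ ∂(hypMeasure θ),
      MemLp (fun s : ℝ => u (s • θ + y)) 2 (volume.restrict (slice Ω θ y)) := by
  have hline := measurePreserving_line hθ
  have hU := ((memLp_indicator_iff_restrict ho.measurableSet).2 hu).comp_measurePreserving hline
  filter_upwards [hU.1.prodMk_left, hU.integrable_sq.prod_right_ae] with y hmeas hint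
  exact (memLp_indicator_iff_restrict (isOpen_slice ho θ y).measurableSet).1
    ((memLp_two_iff_integrable_sq hmeas).2 hint)

theorem IsWeakDirDeriv.ae_slice (ho : IsOpen Ω) (hb : Bornology.IsBounded Ω) (hθ : ‖θ‖ = 1)
    (hu : MemLp u 2 (volume.restrict Ω)) (h : IsWeakDirDeriv Ω θ u v) :
    ∀ᵐ y : hyp θ ∂(hypMeasure θ),
      IsWeakDirDeriv (slice Ω θ y) 1 (fun s => u (s • θ + y)) (fun s => v (s • θ + y)) := by
  have hfin : IsFiniteMeasure (volume.restrict Ω) := isFiniteMeasure_restrict.2 hb.measure_lt_top.ne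
  have hincr : ∀ᵐ x, ∀ n : ℕ, (∀ s ∈ Icc 0 (1 / ((n : ℝ) + 1)), x + s • θ ∈ Ω) →
      u (x + (1 / ((n : ℝ) + 1)) • θ) - u x = ∫ s in 0..1 / ((n : ℝ) + 1), v (x + s • θ) :=
    ae_all_iff.2 fun n => h.aeIncrementEq ho (hu.integrable one_le_two)
      (h.1.integrable one_le_two) (by positivity)
  filter_upwards [ae_memLp_slice ho hθ hu, ae_memLp_slice ho hθ h.1, ae_ae_line hθ hincr]
    with y huy hvy hy
  have hfin' : IsFiniteMeasure (volume.restrict (slice Ω θ y)) :=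
    isFiniteMeasure_restrict.2 ((volume_slice_le hb hθ y).trans_lt ENNReal.ofReal_lt_top).ne
  refine isWeakDirDeriv_of_aeIncrementEq (isOpen_slice ho θ y) (huy.integrable one_le_two)
    (hvy.integrable one_le_two) hvy (t := fun n => 1 / ((n : ℝ) + 1)) (fun n => by positivity)
    tendsto_one_div_add_atTop_nhds_zero_nat fun n => ?_
  have hadd (s t : ℝ) : s • θ + (y : EuclideanSpace ℝ (Fin d)) + t • θ = (s + t • 1) • θ + y := by
    module
  filter_upwards [hy] with s hs hseg
  simpa only [hadd] using hs n fun t ht => by rw [hadd]; exact hseg t ht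

end Lines

section Traces

theorem IsWeakDirDeriv.mono {E : Type*} [NormedAddCommGroup E] [NormedSpace ℝ E] [MeasureSpace E]
    {Ω Ω' : Set E} {θ : E} {u v : E → ℝ} (h : IsWeakDirDeriv Ω θ u v) (hsub : Ω' ⊆ Ω) :
    IsWeakDirDeriv Ω' θ u v := by
  refine ⟨h.1.mono_measure (Measure.restrict_mono_set _ hsub), fun φ hφ hc hsupp => ?_⟩
  have hglobal {f : E → ℝ} (hf : ∀ x ∉ tsupport φ, f x = 0) :
      ∫ x in Ω', f x = ∫ x in Ω, f x := by
    rw [setIntegral_eq_integral_of_forall_compl_eq_zero fun x hx => hf x fun h => hx (hsupp h),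
      setIntegral_eq_integral_of_forall_compl_eq_zero
        fun x hx => hf x fun h => hx (hsub (hsupp h))]
  rw [hglobal fun x hx => by simp [fderiv_of_notMem_tsupport ℝ hx],
    hglobal fun x hx => by simp [image_eq_zero_of_notMem_tsupport hx]]
  exact h.2 φ hφ hc (hsupp.trans hsub)

variable {d : ℕ} {Ω : Set (EuclideanSpace ℝ (Fin d))} {θ y z : EuclideanSpace ℝ (Fin d)}
  {u v w g : EuclideanSpace ℝ (Fin d) → ℝ} {α β c ε : ℝ}

theorem dirAverage_of_isComponentInterval (hc : IsComponentInterval (slice Ω θ y) α β)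
    (u : EuclideanSpace ℝ (Fin d) → ℝ) (ε : ℝ) :
    dirAverage Ω θ u ε (β • θ + y) =
      1 / min ε (β - α) * ∫ s in (0 : ℝ)..min ε (β - α), u ((β - s) • θ + y) := by
  simp only [dirAverage, chordLength_of_isComponentInterval hc, sub_smul, add_sub_right_comm]

/-- The energy `∫ v(x)² dx` on the part in `Ω` of the line through `z` parallel to `θ`. It bounds
the increments of a function with weak derivative `v` along `θ` on every chord of that line. -/
def lineEnergy (Ω : Set (EuclideanSpace ℝ (Fin d))) (θ : EuclideanSpace ℝ (Fin d))
    (v : EuclideanSpace ℝ (Fin d) → ℝ) (z : EuclideanSpace ℝ (Fin d)) : ℝ :=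
  ∫ s in slice Ω θ z, v (s • θ + z) ^ 2

theorem lineEnergy_smul_add (t : ℝ) : lineEnergy Ω θ v (t • θ + y) = lineEnergy Ω θ v y := by
  have htranslate (s : ℝ) : s • θ + (t • θ + y) = (s + t) • θ + y := by module
  have hpre : slice Ω θ (t • θ + y) = (· + t) ⁻¹' slice Ω θ y := by
    ext s
    simp only [slice, mem_preimage, mem_ofPred_eq, htranslate]
  simp only [lineEnergy, hpre, htranslate]
  exact (measurePreserving_add_right volume t).setIntegral_preimage_emb
    (measurableEmbedding_addRight t) (fun s => v (s • θ + y) ^ 2) _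

/-- `v` controls the averages of `u` near `μ_θ`-almost every boundary point `z`: they approach
`g z` at a rate given by the energy of `v` on the line through `z`. Traces enter the estimates only
through this property, which is stable under `μ_θ`-a.e. equality of `g`. -/
def AEDirAverageBound (Ω : Set (EuclideanSpace ℝ (Fin d))) (θ : EuclideanSpace ℝ (Fin d))
    (u v g : EuclideanSpace ℝ (Fin d) → ℝ) : Prop :=
  ∀ᵐ z ∂(dirMeasure Ω θ), ∀ ε : ℝ, 0 < ε →
    (g z - dirAverage Ω θ u ε z) ^ 2 ≤ ε * lineEnergy Ω θ v z

theorem IsEndpointValue.sq_sub_dirAverage_le (hc : IsComponentInterval (slice Ω θ y) α β)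
    (hu : MemLp (fun s : ℝ => u (s • θ + y)) 2 (volume.restrict (slice Ω θ y)))
    (hv : IsWeakDirDeriv (slice Ω θ y) 1 (fun s => u (s • θ + y)) (fun s => v (s • θ + y)))
    (hend : IsEndpointValue (fun s => u (s • θ + y)) α β c) (hε : 0 < ε) :
    (c - dirAverage Ω θ u ε (β • θ + y)) ^ 2 ≤ ε * lineEnergy Ω θ v (β • θ + y) := by
  have hchord : (c - dirAverage Ω θ u ε (β • θ + y)) ^ 2 ≤
      min ε (β - α) * ∫ s in Ioo α β, v (s • θ + y) ^ 2 := by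
    rw [dirAverage_of_isComponentInterval hc]
    exact hend.sq_sub_average_le (hu.mono_measure (Measure.restrict_mono_set _ hc.2.1))
      (hv.mono hc.2.1) (lt_min hε (sub_pos.2 hc.1)) (min_le_right _ _)
  have henergy : ∫ s in Ioo α β, v (s • θ + y) ^ 2 ≤ lineEnergy Ω θ v (β • θ + y) := by
    rw [lineEnergy_smul_add]
    exact setIntegral_mono_set hv.1.integrable_sq (Eventually.of_forall fun s => sq_nonneg _)
      (Eventually.of_forall hc.2.1)
  exact hchord.trans (mul_le_mul (min_le_left _ _) henergy
    (integral_nonneg fun s => sq_nonneg _) hε.le)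

theorem tendsto_dirAverage_of_sq_sub_le {a K : ℝ}
    (h : ∀ ε : ℝ, 0 < ε → (a - dirAverage Ω θ u ε z) ^ 2 ≤ ε * K) :
    Tendsto (fun ε : ℝ => dirAverage Ω θ u ε z) (𝓝[>] 0) (𝓝 a) := by
  have hsqrt : Tendsto (fun ε : ℝ => √(ε * K)) (𝓝[>] 0) (𝓝 0) := by
    have hcont : Continuous fun ε : ℝ => √(ε * K) := by fun_prop
    simpa using (hcont.tendsto 0).mono_left nhdsWithin_le_nhds
  refine tendsto_iff_dist_tendsto_zero.2 (squeeze_zero'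
    (Eventually.of_forall fun _ => dist_nonneg) ?_ hsqrt)
  filter_upwards [self_mem_nhdsWithin] with ε hε
  rw [dist_comm, Real.dist_eq]
  exact Real.abs_le_sqrt (h ε hε)

theorem mem_projSet_of_isComponentInterval (hθ : ‖θ‖ = 1) {y : hyp θ}
    (hc : IsComponentInterval (slice Ω θ y) α β) : y ∈ projSet Ω θ := by
  refine ⟨((α + β) / 2) • θ + y, hc.2.1 ⟨by linarith [hc.1], by linarith [hc.1]⟩, ?_⟩
  have horth : ⟪(y : EuclideanSpace ℝ (Fin d)), θ⟫ = (0 : ℝ) :=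
    Submodule.mem_orthogonal_singleton_iff_inner_left.1 y.2
  simp [inner_add_left, horth, real_inner_smul_left, hθ]

theorem IsDirTrace.ae_isEndpointValue (ho : IsOpen Ω) (hθ : ‖θ‖ = 1) (hg : IsDirTrace Ω θ u g) :
    ∀ᵐ y : hyp θ ∂(hypMeasure θ), ∀ α β : ℝ, IsComponentInterval (slice Ω θ y) α β →
      IsEndpointValue (fun s => u (s • θ + y)) α β (g (β • θ + y)) := by
  obtain ⟨w, hwu, A, -, hA_null, hA⟩ := hg
  filter_upwards [measure_eq_zero_iff_ae_notMem.1 hA_null, ae_ae_slice ho hθ hwu]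
    with y hy hwu_line α β hc
  have hyA : y ∈ A := by
    by_contra h
    exact hy ⟨mem_projSet_of_isComponentInterval hθ hc, h⟩
  obtain ⟨f, hf, hf_cont, hf_end⟩ := (hA y hyA).2 α β hc
  exact ⟨f, hf.trans (ae_restrict_of_ae_restrict_of_subset hc.2.1 hwu_line), hf_cont, hf_end⟩

theorem exists_isDirTrace (ho : IsOpen Ω) (hb : Bornology.IsBounded Ω) (hθ : ‖θ‖ = 1)
    (hu : MemW Ω θ u) : ∃ g, IsDirTrace Ω θ u g := by
  obtain ⟨hu2, v, hv⟩ := hu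
  have hlines := (ae_memLp_slice ho hθ hu2).and (hv.ae_slice ho hb hθ hu2)
  refine ⟨fun z => limUnder (𝓝[>] 0) fun ε : ℝ => dirAverage Ω θ u ε z, u, ae_eq_refl u,
    projSet Ω θ ∩ {y | MemLp (fun s : ℝ => u (s • θ + y)) 2 (volume.restrict (slice Ω θ y)) ∧
      IsWeakDirDeriv (slice Ω θ y) 1 (fun s => u (s • θ + y)) (fun s => v (s • θ + y))},
    inter_subset_left, ?_, ?_⟩
  · rw [sdiff_self_inter]
    exact measure_mono_null (fun y hy => hy.2) (ae_iff.1 hlines)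
  · rintro y ⟨-, huy, hvy⟩
    refine ⟨⟨huy, _, hvy⟩, fun α β hc => ?_⟩
    obtain ⟨a, hend⟩ := exists_isEndpointValue hc.1.le
      (huy.mono_measure (Measure.restrict_mono_set _ hc.2.1)) (hvy.mono hc.2.1)
    have hlim := (tendsto_dirAverage_of_sq_sub_le fun ε hε =>
      hend.sq_sub_dirAverage_le hc huy hvy hε).limUnder_eq
    exact (congrArg (IsEndpointValue (fun s => u (s • θ + y)) α β) hlim).mpr hend

theorem IsDirTrace.aeDirAverageBound (ho : IsOpen Ω) (hb : Bornology.IsBounded Ω) (hθ : ‖θ‖ = 1)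
    (hu : MemLp u 2 (volume.restrict Ω)) (hv : IsWeakDirDeriv Ω θ u v)
    (hg : IsDirTrace Ω θ u g) : AEDirAverageBound Ω θ u v g := by
  refine ae_dirMeasure_of_ae_hypMeasure ho hb hθ ?_
  filter_upwards [hg.ae_isEndpointValue ho hθ, ae_memLp_slice ho hθ hu, hv.ae_slice ho hb hθ hu]
    with y hend huy hvy α β hc ε hε
  exact (hend α β hc).sq_sub_dirAverage_le hc huy hvy hε

theorem AEDirAverageBound.congr_ae {g' : EuclideanSpace ℝ (Fin d) → ℝ}
    (h : AEDirAverageBound Ω θ u v g) (hgg' : g =ᵐ[dirMeasure Ω θ] g') :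
    AEDirAverageBound Ω θ u v g' := by
  filter_upwards [h, hgg'] with z hz heq
  rwa [← heq]

theorem AEDirAverageBound.ae_tendsto (h : AEDirAverageBound Ω θ u v g) :
    ∀ᵐ z ∂(dirMeasure Ω θ), Tendsto (fun ε : ℝ => dirAverage Ω θ u ε z) (𝓝[>] 0) (𝓝 (g z)) :=
  h.mono fun _ => tendsto_dirAverage_of_sq_sub_le

theorem ae_chordLength_pos_and_intervalIntegrable (ho : IsOpen Ω) (hb : Bornology.IsBounded Ω)
    (hθ : ‖θ‖ = 1) (hu : MemLp u 2 (volume.restrict Ω)) :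
    ∀ᵐ z ∂(dirMeasure Ω θ), 0 < chordLength Ω θ z ∧
      IntervalIntegrable (fun s : ℝ => u (z - s • θ)) volume 0 (chordLength Ω θ z) := by
  refine ae_dirMeasure_of_ae_hypMeasure ho hb hθ ?_
  filter_upwards [ae_memLp_slice ho hθ hu] with y huy α β hc
  rw [chordLength_of_isComponentInterval hc]
  refine ⟨sub_pos.2 hc.1, ?_⟩
  simpa only [sub_smul, add_sub_right_comm] using intervalIntegrable_comp_sub_left_of_memLp hc.1.le
    (huy.mono_measure (Measure.restrict_mono_set _ hc.2.1))

theorem dirAverage_congr_ae (ho : IsOpen Ω) (hb : Bornology.IsBounded Ω) (hθ : ‖θ‖ = 1)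
    (huw : u =ᵐ[volume.restrict Ω] w) (hε : 0 < ε) :
    dirAverage Ω θ u ε =ᵐ[dirMeasure Ω θ] dirAverage Ω θ w ε := by
  refine ae_dirMeasure_of_ae_hypMeasure ho hb hθ ?_
  filter_upwards [ae_ae_slice ho hθ huw] with y hy α β hc
  have hlen : 0 < min ε (β - α) := lt_min hε (sub_pos.2 hc.1)
  have hsub : Ioo (β - min ε (β - α)) (β - 0) ⊆ slice Ω θ y := by
    rw [sub_zero]
    exact (Ioo_subset_Ioo_left (by linarith [min_le_right ε (β - α)])).trans hc.2.1
  rw [dirAverage_of_isComponentInterval hc, dirAverage_of_isComponentInterval hc,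
    intervalIntegral.integral_comp_sub_left (fun s => u (s • θ + y)),
    intervalIntegral.integral_comp_sub_left (fun s => w (s • θ + y)),
    intervalIntegral.integral_of_le (by linarith), intervalIntegral.integral_of_le (by linarith),
    integral_Ioc_eq_integral_Ioo, integral_Ioc_eq_integral_Ioo,
    integral_congr_ae (ae_restrict_of_ae_restrict_of_subset hsub hy)]

theorem aemeasurable_dirAverage (ho : IsOpen Ω) (hb : Bornology.IsBounded Ω) (hθ : ‖θ‖ = 1)
    (hu : AEStronglyMeasurable u (volume.restrict Ω)) (hε : 0 < ε) :
    AEMeasurable (dirAverage Ω θ u ε) (dirMeasure Ω θ) := by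
  obtain ⟨w, hw, huw⟩ := hu
  set len := fun z => min ε (chordLength Ω θ z)
  have hlen : Measurable len := measurable_const.min (measurable_chordLength ho hb hθ)
  have hmeas : StronglyMeasurable fun z => ∫ s in (0 : ℝ)..1, w (z - (len z * s) • θ) := by
    simp only [intervalIntegral.integral_of_le zero_le_one]
    exact (hw.comp_measurable (by fun_prop : Measurable fun p : EuclideanSpace ℝ (Fin d) × ℝ =>
      p.1 - (len p.1 * p.2) • θ)).integral_prod_right'
  refine ⟨_, hmeas.measurable, (dirAverage_congr_ae ho hb hθ huw hε).trans ?_⟩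
  filter_upwards [ae_mem_dirBoundary ho hb hθ] with z hz
  rw [dirBoundary_eq ho hb hθ] at hz
  have hpos : len z ≠ 0 := (lt_min hε hz.2).ne'
  rw [intervalIntegral.integral_comp_mul_left (fun s => w (z - s • θ)) hpos, dirAverage,
    mul_zero, mul_one, smul_eq_mul, one_div]

theorem AEDirAverageBound.aemeasurable (ho : IsOpen Ω) (hb : Bornology.IsBounded Ω)
    (hθ : ‖θ‖ = 1) (hu : AEStronglyMeasurable u (volume.restrict Ω))
    (h : AEDirAverageBound Ω θ u v g) : AEMeasurable g (dirMeasure Ω θ) := by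
  have hseq : Tendsto (fun n : ℕ => 1 / ((n : ℝ) + 1)) atTop (𝓝[>] 0) :=
    tendsto_nhdsWithin_iff.2 ⟨tendsto_one_div_add_atTop_nhds_zero_nat,
      Eventually.of_forall fun n => mem_Ioi.2 Nat.one_div_pos_of_nat⟩
  exact aemeasurable_of_tendsto_metrizable_ae atTop
    (fun n => aemeasurable_dirAverage ho hb hθ hu Nat.one_div_pos_of_nat)
    (h.ae_tendsto.mono fun z hz => hz.comp hseq)

end Traces

section Energy

variable {d : ℕ} {Ω : Set (EuclideanSpace ℝ (Fin d))} {θ : EuclideanSpace ℝ (Fin d)}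
  {u v g : EuclideanSpace ℝ (Fin d) → ℝ} {ε : ℝ}

theorem lintegral_lintegral_add_smul (θ : EuclideanSpace ℝ (Fin d))
    {k : ℝ × EuclideanSpace ℝ (Fin d) → ENNReal} (hk : AEMeasurable k (volume.prod volume)) :
    ∫⁻ x, ∫⁻ s, k (s, x + s • θ) = ∫⁻ x, ∫⁻ s, k (s, x) := by
  have hshear := measurePreserving_shear (μ := (volume : Measure (EuclideanSpace ℝ (Fin d))))
    volume θ
  rw [← lintegral_prod_symm k hk, ← hshear.map_eq,
    lintegral_map' (by rwa [hshear.map_eq]) hshear.aemeasurable]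
  exact (lintegral_prod_symm _
    (hk.comp_quasiMeasurePreserving hshear.quasiMeasurePreserving)).symm

theorem setLIntegral_setLIntegral_slice_le (ho : IsOpen Ω) (hb : Bornology.IsBounded Ω)
    (hθ : ‖θ‖ = 1) {F : EuclideanSpace ℝ (Fin d) → ENNReal}
    (hF : AEMeasurable F (volume.restrict Ω)) :
    ∫⁻ x in Ω, ∫⁻ s in slice Ω θ x, F (s • θ + x) ≤
      ENNReal.ofReal (Metric.diam Ω) * ∫⁻ x in Ω, F x := by
  set k : ℝ × EuclideanSpace ℝ (Fin d) → ENNReal :=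
    fun p => Ω.indicator 1 (p.2 - p.1 • θ) * Ω.indicator F p.2
  have hk : AEMeasurable k (volume.prod volume) :=
    ((measurable_one.indicator ho.measurableSet).comp (by fun_prop)).aemeasurable.mul
      ((aemeasurable_indicator_iff ho.measurableSet).2 hF).comp_snd
  have hleft (x : EuclideanSpace ℝ (Fin d)) :
      Ω.indicator (fun x => ∫⁻ s in slice Ω θ x, F (s • θ + x)) x =
        ∫⁻ s : ℝ, k (s, x + s • θ) := by
    by_cases hx : x ∈ Ω
    · rw [indicator_of_mem hx, ← lintegral_indicator (isOpen_slice ho θ x).measurableSet]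
      refine lintegral_congr fun s => ?_
      simp only [k, add_sub_cancel_right, indicator_of_mem hx, Pi.one_apply, one_mul]
      rw [add_comm x]
      rfl
    · simp [k, hx]
  have hright (x : EuclideanSpace ℝ (Fin d)) :
      ∫⁻ s : ℝ, k (s, x) ≤ ENNReal.ofReal (Metric.diam Ω) * Ω.indicator F x := by
    have hslice (s : ℝ) : Ω.indicator 1 (x - s • θ) =
        (slice Ω (-θ) x).indicator (1 : ℝ → ENNReal) s := by
      rw [sub_eq_neg_add, ← smul_neg]
      rfl
    have hmeas := (isOpen_slice ho (-θ) x).measurableSet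
    simp only [k, hslice]
    rw [lintegral_mul_const _ (measurable_one.indicator hmeas), lintegral_indicator_one hmeas]
    gcongr
    exact volume_slice_le hb (by rwa [norm_neg]) x
  calc ∫⁻ x in Ω, ∫⁻ s in slice Ω θ x, F (s • θ + x)
      = ∫⁻ x, ∫⁻ s : ℝ, k (s, x + s • θ) := by
        rw [← lintegral_indicator ho.measurableSet]
        exact lintegral_congr hleft
    _ = ∫⁻ x, ∫⁻ s : ℝ, k (s, x) := lintegral_lintegral_add_smul θ hk
    _ ≤ ∫⁻ x, ENNReal.ofReal (Metric.diam Ω) * Ω.indicator F x := lintegral_mono hright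
    _ = ENNReal.ofReal (Metric.diam Ω) * ∫⁻ x in Ω, F x := by
        rw [lintegral_const_mul' _ _ ENNReal.ofReal_ne_top, lintegral_indicator ho.measurableSet]

theorem lintegral_lineEnergy_dirMeasure_le (ho : IsOpen Ω) (hb : Bornology.IsBounded Ω)
    (hθ : ‖θ‖ = 1) (hv : MemLp v 2 (volume.restrict Ω)) :
    ∫⁻ z, ENNReal.ofReal (lineEnergy Ω θ v z) ∂(dirMeasure Ω θ) ≤
      ENNReal.ofReal (Metric.diam Ω * ∫ x in Ω, v x ^ 2) := by
  calc ∫⁻ z, ENNReal.ofReal (lineEnergy Ω θ v z) ∂(dirMeasure Ω θ)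
      ≤ ∫⁻ x in Ω, ENNReal.ofReal (lineEnergy Ω θ v (Phi Ω θ x)) := lintegral_map_le _ _
    _ ≤ ∫⁻ x in Ω, ∫⁻ s in slice Ω θ x, ‖v (s • θ + x) ^ 2‖ₑ := lintegral_mono fun x => by
        rw [Phi, add_comm, lineEnergy_smul_add]
        exact (Real.ofReal_le_enorm _).trans (enorm_integral_le_lintegral_enorm _)
    _ ≤ ENNReal.ofReal (Metric.diam Ω) * ∫⁻ x in Ω, ‖v x ^ 2‖ₑ :=
        setLIntegral_setLIntegral_slice_le ho hb hθ (hv.aestronglyMeasurable.pow 2).enorm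
    _ = ENNReal.ofReal (Metric.diam Ω * ∫ x in Ω, v x ^ 2) := by
        rw [ENNReal.ofReal_mul Metric.diam_nonneg,
          ofReal_integral_eq_lintegral_ofReal hv.integrable_sq
            (Eventually.of_forall fun x => sq_nonneg _)]
        simp only [Real.enorm_of_nonneg (sq_nonneg _)]

theorem AEDirAverageBound.lintegral_sq_sub_dirAverage_le (ho : IsOpen Ω)
    (hb : Bornology.IsBounded Ω) (hθ : ‖θ‖ = 1) (hv : MemLp v 2 (volume.restrict Ω))
    (h : AEDirAverageBound Ω θ u v g) (hε : 0 < ε) :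
    ∫⁻ z, ENNReal.ofReal ((g z - dirAverage Ω θ u ε z) ^ 2) ∂(dirMeasure Ω θ) ≤
      ENNReal.ofReal (ε * Metric.diam Ω * ∫ x in Ω, v x ^ 2) := by
  calc ∫⁻ z, ENNReal.ofReal ((g z - dirAverage Ω θ u ε z) ^ 2) ∂(dirMeasure Ω θ)
      ≤ ∫⁻ z, ENNReal.ofReal ε * ENNReal.ofReal (lineEnergy Ω θ v z) ∂(dirMeasure Ω θ) :=
        lintegral_mono_ae <| h.mono fun z hz => by
          rw [← ENNReal.ofReal_mul hε.le]
          exact ENNReal.ofReal_le_ofReal (hz ε hε)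
    _ ≤ ENNReal.ofReal ε * ENNReal.ofReal (Metric.diam Ω * ∫ x in Ω, v x ^ 2) := by
        rw [lintegral_const_mul' _ _ ENNReal.ofReal_ne_top]
        gcongr
        exact lintegral_lineEnergy_dirMeasure_le ho hb hθ hv
    _ = ENNReal.ofReal (ε * Metric.diam Ω * ∫ x in Ω, v x ^ 2) := by
        rw [← ENNReal.ofReal_mul hε.le, mul_assoc]

theorem AEDirAverageBound.memLp_and_integral_sq_sub_dirAverage_le (ho : IsOpen Ω)
    (hb : Bornology.IsBounded Ω) (hθ : ‖θ‖ = 1) (hu : AEStronglyMeasurable u (volume.restrict Ω))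
    (hv : MemLp v 2 (volume.restrict Ω)) (h : AEDirAverageBound Ω θ u v g) (hε : 0 < ε) :
    MemLp (fun z => g z - dirAverage Ω θ u ε z) 2
        ((dirMeasure Ω θ).restrict (dirBoundary Ω θ)) ∧
      ∫ z in dirBoundary Ω θ, (g z - dirAverage Ω θ u ε z) ^ 2 ∂(dirMeasure Ω θ) ≤
        ε * Metric.diam Ω * ∫ x in Ω, v x ^ 2 := by
  have hmeas : AEMeasurable (fun z => g z - dirAverage Ω θ u ε z)
      ((dirMeasure Ω θ).restrict (dirBoundary Ω θ)) :=
    ((h.aemeasurable ho hb hθ hu).sub (aemeasurable_dirAverage ho hb hθ hu hε)).restrict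
  have hle := (setLIntegral_le_lintegral (dirBoundary Ω θ) _).trans
    (h.lintegral_sq_sub_dirAverage_le ho hb hθ hv hε)
  have hsq_nonneg : 0 ≤ᵐ[(dirMeasure Ω θ).restrict (dirBoundary Ω θ)]
      fun z => (g z - dirAverage Ω θ u ε z) ^ 2 := Eventually.of_forall fun z => sq_nonneg _
  have hsq_meas := (hmeas.pow_const 2).aestronglyMeasurable
  constructor
  · exact (memLp_two_iff_integrable_sq hmeas.aestronglyMeasurable).2
      ⟨hsq_meas, (hasFiniteIntegral_iff_ofReal hsq_nonneg).2 (hle.trans_lt ENNReal.ofReal_lt_top)⟩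
  · rw [integral_eq_lintegral_of_nonneg_ae hsq_nonneg hsq_meas]
    exact ENNReal.toReal_le_of_le_ofReal (mul_nonneg (mul_nonneg hε.le Metric.diam_nonneg)
      (integral_nonneg fun x => sq_nonneg _)) hle

end Energy

section Gradient

variable {d : ℕ} {Ω : Set (EuclideanSpace ℝ (Fin d))} {u : EuclideanSpace ℝ (Fin d) → ℝ}
  {G : EuclideanSpace ℝ (Fin d) → EuclideanSpace ℝ (Fin d)}

theorem IsWeakGrad.memLp (hG : IsWeakGrad Ω u G) : MemLp G 2 (volume.restrict Ω) :=
  MemLp.of_eval_piLp fun i => (hG i).1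

theorem IsWeakGrad.isWeakDirDeriv_inner (hu : MemLp u 2 (volume.restrict Ω))
    (hG : IsWeakGrad Ω u G) (θ : EuclideanSpace ℝ (Fin d)) :
    IsWeakDirDeriv Ω θ u fun x => ⟪G x, θ⟫ := by
  have hθ : ∑ i, θ i • EuclideanSpace.single i (1 : ℝ) = θ := by
    simpa using (EuclideanSpace.basisFun (Fin d) ℝ).sum_repr θ
  have hinner (x) : ∑ i, θ i * G x i = ⟪G x, θ⟫ := by simp [PiLp.inner_apply]
  simpa only [hθ, hinner] using IsWeakDirDeriv.sum_smul hu hG θ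

theorem integral_inner_sq_le (hG : MemLp G 2 (volume.restrict Ω)) {θ : EuclideanSpace ℝ (Fin d)}
    (hθ : ‖θ‖ = 1) : ∫ x in Ω, ⟪G x, θ⟫ ^ 2 ≤ ∫ x in Ω, ‖G x‖ ^ 2 := by
  refine integral_mono_of_nonneg (Eventually.of_forall fun x => sq_nonneg _) hG.norm.integrable_sq
    (Eventually.of_forall fun x => sq_le_sq.2 ?_)
  rw [abs_norm]
  simpa [hθ] using abs_real_inner_le_norm (G x) θ

theorem IsOmniTrace.aeDirAverageBound {g : EuclideanSpace ℝ (Fin d) → ℝ}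
    {θ : EuclideanSpace ℝ (Fin d)} (ho : IsOpen Ω) (hb : Bornology.IsBounded Ω)
    (hu : MemLp u 2 (volume.restrict Ω)) (hG : IsWeakGrad Ω u G) (hg : IsOmniTrace Ω u g)
    (hθ : θ ∈ Metric.sphere 0 1) : AEDirAverageBound Ω θ u (fun x => ⟪G x, θ⟫) g := by
  obtain ⟨γ, hγ, hγg⟩ := hg.2 θ hθ
  exact (hγ.aeDirAverageBound ho hb (mem_sphere_zero_iff_norm.1 hθ) hu
    (hG.isWeakDirDeriv_inner hu θ)).congr_ae hγg

end Gradient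

end

end DirTrace

theorem mainTheorem8 (d : ℕ) (hd : 1 ≤ d) (Ω : Set (EuclideanSpace ℝ (Fin d)))
    (hΩo : IsOpen Ω) (hΩb : Bornology.IsBounded Ω) :
    -- a fixed direction
    (∀ θ ∈ Metric.sphere (0 : EuclideanSpace ℝ (Fin d)) 1,
      ∀ u : EuclideanSpace ℝ (Fin d) → ℝ, DirTrace.MemW Ω θ u →
        (∃ g, DirTrace.IsDirTrace Ω θ u g) ∧
        (∀ᵐ z ∂(DirTrace.dirMeasure Ω θ), z ∈ DirTrace.dirBoundary Ω θ →
          0 < DirTrace.chordLength Ω θ z ∧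
          IntervalIntegrable (fun s : ℝ => u (z - s • θ)) volume 0 (DirTrace.chordLength Ω θ z)) ∧
        ∀ g, DirTrace.IsDirTrace Ω θ u g →
          (∀ᵐ z ∂(DirTrace.dirMeasure Ω θ), z ∈ DirTrace.dirBoundary Ω θ →
            Tendsto (fun ε : ℝ => DirTrace.dirAverage Ω θ u ε z) (𝓝[>] 0) (𝓝 (g z))) ∧
          ∀ v, DirTrace.IsWeakDirDeriv Ω θ u v → ∀ ε : ℝ, 0 < ε →
            MemLp (fun z => g z - DirTrace.dirAverage Ω θ u ε z) 2
              ((DirTrace.dirMeasure Ω θ).restrict (DirTrace.dirBoundary Ω θ)) ∧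
            ∫ z in DirTrace.dirBoundary Ω θ, (g z - DirTrace.dirAverage Ω θ u ε z) ^ 2
                ∂(DirTrace.dirMeasure Ω θ)
              ≤ ε * Metric.diam Ω * ∫ x in Ω, v x ^ 2) ∧
    -- all directions
    (∀ u : EuclideanSpace ℝ (Fin d) → ℝ, DirTrace.MemH1tr Ω u →
      ∀ g, DirTrace.IsOmniTrace Ω u g →
        (∀ θ ∈ Metric.sphere (0 : EuclideanSpace ℝ (Fin d)) 1,
          ∀ᵐ z ∂(DirTrace.dirMeasure Ω θ), z ∈ DirTrace.dirBoundary Ω θ →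
            (0 < DirTrace.chordLength Ω θ z ∧
            IntervalIntegrable (fun s : ℝ => u (z - s • θ)) volume 0
              (DirTrace.chordLength Ω θ z)) ∧
            Tendsto (fun ε : ℝ => DirTrace.dirAverage Ω θ u ε z) (𝓝[>] 0) (𝓝 (g z))) ∧
        ∀ G, DirTrace.IsWeakGrad Ω u G → ∀ ε : ℝ, 0 < ε →
          ∀ θ ∈ Metric.sphere (0 : EuclideanSpace ℝ (Fin d)) 1,
            MemLp (fun z => g z - DirTrace.dirAverage Ω θ u ε z) 2
              ((DirTrace.dirMeasure Ω θ).restrict (DirTrace.dirBoundary Ω θ)) ∧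
            ∫ z in DirTrace.dirBoundary Ω θ, (g z - DirTrace.dirAverage Ω θ u ε z) ^ 2
                ∂(DirTrace.dirMeasure Ω θ)
              ≤ ε * Metric.diam Ω * ∫ x in Ω, ‖G x‖ ^ 2) := by
  constructor
  · rintro θ hθ u ⟨hu, v₀, hv₀⟩
    rw [mem_sphere_zero_iff_norm] at hθ
    refine ⟨DirTrace.exists_isDirTrace hΩo hΩb hθ ⟨hu, v₀, hv₀⟩,
      (DirTrace.ae_chordLength_pos_and_intervalIntegrable hΩo hΩb hθ hu).mono fun z hz _ => hz,
      fun g hg => ⟨?_, fun v hv ε hε => ?_⟩⟩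
    · exact (hg.aeDirAverageBound hΩo hΩb hθ hu hv₀).ae_tendsto.mono fun z hz _ => hz
    · exact (hg.aeDirAverageBound hΩo hΩb hθ hu hv).memLp_and_integral_sq_sub_dirAverage_le
        hΩo hΩb hθ hu.1 hv.1 hε
  · rintro u ⟨⟨hu, G₀, hG₀⟩, -⟩ g hg
    refine ⟨fun θ hθ => ?_, fun G hG ε hε θ hθ => ?_⟩
    · have hbound := hg.aeDirAverageBound hΩo hΩb hu hG₀ hθ
      filter_upwards [DirTrace.ae_chordLength_pos_and_intervalIntegrable hΩo hΩb
        (mem_sphere_zero_iff_norm.1 hθ) hu, hbound.ae_tendsto] with z hz hlim _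
      exact ⟨hz, hlim⟩
    · have hbound := hg.aeDirAverageBound hΩo hΩb hu hG hθ
      rw [mem_sphere_zero_iff_norm] at hθ
      obtain ⟨hmem, hle⟩ := hbound.memLp_and_integral_sq_sub_dirAverage_le hΩo hΩb hθ hu.1
        (hG.isWeakDirDeriv_inner hu θ).1 hε
      exact ⟨hmem, hle.trans (mul_le_mul_of_nonneg_left (DirTrace.integral_inner_sq_le hG.memLp hθ)
        (mul_nonneg hε.le Metric.diam_nonneg))⟩
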